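/- **Algorithms.** Let $f:\mathbb{R}^d\to\mathbb{R}$ be twice continuously differentiable. For a differentiable $g$, a positive semidefinite $H$ and $M>0$, the cubic regularized Newton (CRN) step $\mathcal{A}^{g}_{M}(\bar z,H)$ is the solution $z$ of $\nabla g(\bar z)+H(z-\bar z)+\frac{M}{2}\|z-\bar z\|(z-\bar z)=0$. *MS-Solver* at $\bar z$, with parameters $L,K,M,m,\gamma$: put $g(z)=f(z)+\frac{\gamma}{3}\|z-\bar z\|^3$ and $z^{(0)}=\mathcal{A}^{g}_{L}(\bar z,\nabla^2 g(\bar z))$; for $s=0,\dots,\lceil K/m\rceil-1$ put $z_{s,0}=z^{(s)}$, $z_{s,t+1}=\mathcal{A}^{g}_{M}(z_{s,t},\nabla^2 g(z_{s,0}))$ for $0\le t<m$, and $z^{(s+1)}=\frac1m\sum_{t=1}^m z_{s,t}$; return $\mathcal{A}^{g}_{L}(z^{(N)},\nabla^2 g(z^{(N)}))$ with $N=\lceil K/m\rceil$. *A-LEN* from $z_0$, with $T$ iterations and parameter $\alpha$: put $v_0=z_0$, $A_0=0$, let $\tilde z_1$ be the output of MS-Solver at $z_0$ and $\lambda_1'=\lambda_1=\gamma\|\tilde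 z_1-z_0\|$; if $\tilde z_1=z_0$, stop and return $z_0$. For $t=0,\dots,T-1$: $a'_{t+1}=\frac{1}{2\lambda'_{t+1}}\bigl(1+\sqrt{1+4\lambda'_{t+1}A_t}\bigr)$, $A'_{t+1}=A_t+a'_{t+1}$, $\bar z_t=\frac{A_t}{A'_{t+1}}z_t+\frac{a'_{t+1}}{A'_{t+1}}v_t$; if $t>0$, let $\tilde z_{t+1}$ be the output of MS-Solver at $\bar z_t$ and $\lambda_{t+1}=\gamma\|\tilde z_{t+1}-\bar z_t\|$. If $\lambda_{t+1}\le\lambda'_{t+1}$, put $a_{t+1}=a'_{t+1}$, $A_{t+1}=A'_{t+1}$, $z_{t+1}=\tilde z_{t+1}$, $\lambda'_{t+2}=\lambda'_{t+1}/\alpha$; otherwise, with $\rho=\lambda'_{t+1}/\lambda_{t+1}$, put $a_{t+1}=\rho a'_{t+1}$, $A_{t+1}=A_t+a_{t+1}$, $z_{t+1}=\frac{(1-\rho)A_t}{A_{t+1}}z_t+\frac{\rho A'_{t+1}}{A_{t+1}}\tilde z_{t+1}$, $\lambda'_{t+2}=\alpha\lambda'_{t+1}$. In both cases $v_{t+1}=v_t-a_{t+1}\nabla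 f(\tilde z_{t+1})$. Return $z_T$. *A-LEN-restart* from $z_0$: $z^{(0)}=z_0$, and $z^{(s+1)}$ is the output of A-LEN started at $z^{(s)}$. **Theorem.** There are absolute constants $c_K,c_T>0$, and for all $C_K,C_T$ there is a constant $C>0$ depending only on $C_K,C_T$, such that the following holds for all $d\ge 0$, $m\ge1$, $\mu,L>0$, every $\mu$-strongly convex $C^2$ function $f:\mathbb{R}^d\to\mathbb{R}$ with $L$-Lipschitz Hessian, with minimizer $z^*$, and every $z_0\in\mathbb{R}^d$. Put $D=\|z_0-z^*\|$, $\kappa=L/\mu$, and run A-LEN-restart from $z_0$ with $\alpha=2$, $\gamma=L/m$, $M=6m(L+2\gamma)$ (so $M=\mathcal{O}(mL)$) and integers $K\ge c_K\,m(1+\log m)$ and $T\ge 1$ with $T\ge c_T(\gamma D/\mu)^{2/7}$. For $\varepsilon\in(0,\frac12)$ let $S_\varepsilon=\lceil\log_{3/2}\log_2(1/\varepsilon)\rceil$. 1. For all $s\ge1$: $\|z^{(s)}-z^*\|^2\le\left(\tfrac12\right)^{(3/2)^s}\|z_0-z^*\|^2$. 2. For all $\varepsilon\in(0,\frac12)$: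 $\|z^{(S_\varepsilon)}-z^*\|\le\varepsilon\,\|z_0-z^*\|$. If moreover $T\ge c_T(\gamma D^3/\mu)^{2/7}$, then $\|z^{(S_\varepsilon)}-z^*\|\le\varepsilon$ for all $\varepsilon\in(0,\frac12)$. 3. If $K\le C_K\,m(1+\log m)$ and $T\le C_T(\gamma/\mu)^{2/7}$, then for all $\varepsilon\in(0,\frac14]$ both $S_\varepsilon(m+TK)$ and the number of CRN steps performed in the first $S_\varepsilon$ epochs are at most $$C\left(m+m^{5/7}(1+\log m)\,\kappa^{2/7}\right)\log\log(1/\varepsilon).$$ 4. If only $K\le C_K\,m(1+\log m)$ and $T\le C_T\bigl(1+(\gamma/\mu)^{2/7}\bigr)$, then for all $\varepsilon\in(0,\frac14]$ both numbers are at most $$C\left(m+m^{5/7}\kappa^{2/7}\right)(1+\log m)\log\log(1/\varepsilon).$$ -/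

import Mathlib

namespace LazyNewton

variable {E : Type*} [NormedAddCommGroup E] [InnerProductSpace ℝ E] [CompleteSpace E]

/-- The Hessian of `g` at `z`, as a continuous linear operator: the derivative of the gradient. -/
noncomputable def hess (g : E → ℝ) (z : E) : E →L[ℝ] E :=
  fderiv ℝ (gradient g) z

/-- `f` is twice continuously differentiable with `L`-Lipschitz Hessian (operator norm). -/
def HasLipschitzHessian (L : ℝ) (f : E → ℝ) : Prop :=
  ContDiff ℝ 2 f ∧ ∀ z z' : E, ‖hess f z - hess f z'‖ ≤ L * ‖z - z'‖

/-- The cubic regularized Newton (CRN) oracle of an operator `F` at `zbar` with matrix `H`: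
the set of solutions of `F zbar + H (z - zbar) + (M / 2) ‖z - zbar‖ (z - zbar) = 0`. -/
def crnOracle (M : ℝ) (F : E → E) (zbar : E) (H : E →L[ℝ] E) : Set E :=
  {z | F zbar + H (z - zbar) + (M / 2 * ‖z - zbar‖) • (z - zbar) = 0}

open Classical in
/-- One CRN step: a point of the oracle set. (For positive semidefinite `H` and `M > 0`, the only
case that occurs for convex functions, the oracle set has exactly one element; the value `zbar`
for an empty oracle set is a mere default.) -/
noncomputable def crnStep (M : ℝ) (F : E → E) (zbar : E) (H : E →L[ℝ] E) : E :=
  if h : (crnOracle M F zbar H).Nonempty then h.some else zbar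

/-- The second-order proximal function `z ↦ f z + (γ / 3) ‖z - zbar‖ ^ 3`. -/
noncomputable def proxFun (f : E → ℝ) (γ : ℝ) (zbar : E) : E → ℝ :=
  fun z => f z + γ / 3 * ‖z - zbar‖ ^ 3

/-- The lazy iterates `z_{s,0} = zs, …, z_{s,t}, …` within one epoch of the MS-solver: CRN steps
for `g`, all of them with the Hessian of `g` at the snapshot `zs`. -/
noncomputable def lazyIterate (g : E → ℝ) (M : ℝ) (zs : E) : ℕ → E
  | 0 => zs
  | t + 1 => crnStep M (gradient g) (lazyIterate g M zs t) (hess g zs)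

/-- One epoch of the MS-solver: `m` lazy CRN steps, followed by averaging. -/
noncomputable def lazyEpoch (g : E → ℝ) (M : ℝ) (m : ℕ) (zs : E) : E :=
  (1 / (m : ℝ)) • ∑ t ∈ Finset.Icc 1 m, lazyIterate g M zs t

/-- The MS-solver: a CRN step with parameter `L`, then `⌈K / m⌉` lazy epochs with parameter `M`,
then a CRN step with parameter `L`, all applied to `g = proxFun f γ zbar`. -/
noncomputable def msSolver (f : E → ℝ) (L : ℝ) (K : ℕ) (M : ℝ) (m : ℕ) (γ : ℝ) (zbar : E) : E :=
  let g := proxFun f γ zbar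
  let zfirst := crnStep L (gradient g) zbar (hess g zbar)
  let zlast := (lazyEpoch g M m)^[⌈(K : ℝ) / (m : ℝ)⌉₊] zfirst
  crnStep L (gradient g) zlast (hess g zlast)

/-- The number of CRN steps performed in one call of `msSolver`. -/
noncomputable def msSolverSteps (K m : ℕ) : ℕ :=
  1 + ⌈(K : ℝ) / (m : ℝ)⌉₊ * m + 1

/-- The state of A-LEN after `t` iterations: `z = z_t`, `v = v_t`, `A = A_t`,
`lam = λ'_{t+1}`, and the number of CRN steps performed so far. -/
structure ALenState (E : Type*) where
  z : E
  v : E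
  A : ℝ
  lam : ℝ
  steps : ℕ

/-- The state after `t` iterations of the loop of A-LEN started at `z₀`. The point `z1` is the
output of the MS-solver at `z₀`, which is computed before the loop and used for `t = 0`. -/
noncomputable def alenIter (f : E → ℝ) (L α : ℝ) (K : ℕ) (M : ℝ) (m : ℕ) (γ : ℝ) (z₀ z1 : E) :
    ℕ → ALenState E
  | 0 => ⟨z₀, z₀, 0, γ * ‖z1 - z₀‖, msSolverSteps K m⟩
  | t + 1 =>
    let st := alenIter f L α K M m γ z₀ z1 t
    let a' := 1 / (2 * st.lam) * (1 + √(1 + 4 * st.lam * st.A))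
    let A' := st.A + a'
    let zbar := (st.A / A') • st.z + (a' / A') • st.v
    let ztilde := if t = 0 then z1 else msSolver f L K M m γ zbar
    let lamNew := if t = 0 then st.lam else γ * ‖ztilde - zbar‖
    let stepsNew := if t = 0 then st.steps else st.steps + msSolverSteps K m
    if lamNew ≤ st.lam then
      { z := ztilde
        v := st.v - a' • gradient f ztilde
        A := A'
        lam := 1 / α * st.lam
        steps := stepsNew }
    else
      let ρ := st.lam / lamNew
      let a := ρ * a'
      let A := st.A + a
      { z := ((1 - ρ) * st.A / A) • st.z + (ρ * A' / A) • ztilde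
        v := st.v - a • gradient f ztilde
        A := A
        lam := α * st.lam
        steps := stepsNew }

open Classical in
/-- A-LEN with `T` iterations from `z₀`: the output and the number of CRN steps. If the first call
of the MS-solver returns `z₀` itself, then `λ'_1 = 0` and the weights `1 / (2 λ'_1)` of the method
are undefined; in that case the method stops and returns `z₀`. -/
noncomputable def alen (f : E → ℝ) (L : ℝ) (z₀ : E) (T : ℕ) (α : ℝ) (K : ℕ) (M : ℝ) (m : ℕ)
    (γ : ℝ) : E × ℕ :=
  let z1 := msSolver f L K M m γ z₀
  if z1 = z₀ then (z₀, msSolverSteps K m)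
  else
    let st := alenIter f L α K M m γ z₀ z1 T
    (st.z, st.steps)

/-- A-LEN-restart: the point `z^{(s)}` after `s` epochs, and the total number of CRN steps
performed in these epochs. -/
noncomputable def alenRestart (f : E → ℝ) (L : ℝ) (z₀ : E) (T : ℕ) (α : ℝ) (K : ℕ) (M : ℝ)
    (m : ℕ) (γ : ℝ) : ℕ → E × ℕ
  | 0 => (z₀, 0)
  | s + 1 =>
    let p := alenRestart f L z₀ T α K M m γ s
    let q := alen f L p.1 T α K M m γ
    (q.1, p.2 + q.2)

/-- The number of epochs `⌈log_{3/2} log_2 (1 / ε)⌉`. -/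
noncomputable def numEpochs (ε : ℝ) : ℕ :=
  ⌈Real.logb (3 / 2) (Real.logb 2 (1 / ε))⌉₊

end LazyNewton

/-!
The proximal function `g = f + (γ / 3) ‖· - zbar‖ ^ 3` is uniformly convex of degree three and has
an `(L + 4 γ)`-Lipschitz Hessian. With `M` of order `m L`, the error made by reusing a Hessian for
`m` steps is absorbed by the cubes of the step lengths: their sum is controlled by the decrease
of `g`, and in turn controls the gaps `g - min g` along the epoch. So an epoch contracts the gap by
a constant factor, and `K ∼ m (1 + log m)` lazy steps reduce it by any fixed power of `1 / m`. This
is enough for the last step of the solver to produce a proximal point `y` of `f` at `zbar` with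
parameter `λ = γ ‖y - zbar‖`, up to a fixed relative error.

In A-LEN, the guess `λ'` of this parameter either is halved, and then `√A` grows by at least
`1 / (2 √λ')`, or is doubled, and then the potential `A (f z - f w) + ‖v - w‖ ^ 2 / 2`, with `w` the
minimizer, drops by a multiple of `A λ' ^ 3 / γ ^ 2`. Following the distance of `log λ'` from the
level at which the two gains balance shows `A ≳ T ^ (7 / 2) / (γ D)`, hence
`f z - f w ≲ γ D ^ 3 / T ^ (7 / 2)`. As the right-hand side is cubic in `D` while strong convexity
bounds the left-hand side below by a square, restarting converges superlinearly, with exponent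
`3 / 2`.
-/

namespace LazyNewton

open Filter Topology
open scoped InnerProductSpace

section Convexity

variable {E : Type*} [NormedAddCommGroup E] [InnerProductSpace ℝ E]

theorem hasDerivAt_comp_lineMap [CompleteSpace E] {f : E → ℝ} {x : E}
    (hf : DifferentiableAt ℝ f x) (y : E) :
    HasDerivAt (fun t : ℝ => f (AffineMap.lineMap x y t)) ⟪gradient f x, y - x⟫_ℝ 0 := by
  have hf' : DifferentiableAt ℝ f (AffineMap.lineMap x y (0 : ℝ)) := by simpa using hf
  have h := hf'.hasFDerivAt.comp_hasDerivAt (0 : ℝ) AffineMap.hasDerivAt_lineMap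
  rw [AffineMap.lineMap_apply_zero] at h
  rwa [inner_gradient_left]

theorem add_inner_gradient_le_of_convexOn [CompleteSpace E] {f : E → ℝ}
    (hf : ConvexOn ℝ Set.univ f) {x : E} (hd : DifferentiableAt ℝ f x) (y : E) :
    f x + ⟪gradient f x, y - x⟫_ℝ ≤ f y := by
  have hline : ConvexOn ℝ Set.univ (f ∘ AffineMap.lineMap (k := ℝ) x y) := by
    simpa using hf.comp_affineMap (AffineMap.lineMap x y)
  have hslope := hline.le_slope_of_hasDerivAt (Set.mem_univ 0) (Set.mem_univ 1) one_pos
    (hasDerivAt_comp_lineMap hd y)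
  simp only [slope_def_field, Function.comp_apply, AffineMap.lineMap_apply_one,
    AffineMap.lineMap_apply_zero, sub_zero, div_one] at hslope
  linarith

theorem inner_gradient_sub_nonneg_of_convexOn [CompleteSpace E] {f : E → ℝ}
    (hf : ConvexOn ℝ Set.univ f) (hd : Differentiable ℝ f) (x y : E) :
    0 ≤ ⟪gradient f y - gradient f x, y - x⟫_ℝ := by
  have hxy := add_inner_gradient_le_of_convexOn hf (hd x) y
  have hyx := add_inner_gradient_le_of_convexOn hf (hd y) x
  rw [← neg_sub y x, inner_neg_right] at hyx
  rw [inner_sub_left]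
  linarith

theorem gradient_eq_zero_of_forall_le [CompleteSpace E] {f : E → ℝ} {w : E}
    (h : ∀ z, f w ≤ f z) : gradient f w = 0 := by
  have hmin : IsLocalMin f w := Eventually.of_forall h
  simp [gradient, hmin.fderiv_eq_zero]

theorem half_mul_norm_sq_le_sub_of_strongConvexOn {f : E → ℝ} {μ : ℝ}
    (hf : StrongConvexOn Set.univ μ f) {w : E} (hw : ∀ z, f w ≤ f z) (y : E) :
    μ / 2 * ‖y - w‖ ^ 2 ≤ f y - f w := by
  have hIoo : ∀ t ∈ Set.Ioo (0 : ℝ) 1, t * (μ / 2 * ‖y - w‖ ^ 2) ≤ f y - f w := by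
    rintro t ⟨ht0, ht1⟩
    have hconv := hf.2 (Set.mem_univ y) (Set.mem_univ w) (sub_nonneg.2 ht1.le) ht0.le
      (sub_add_cancel 1 t)
    simp only [smul_eq_mul] at hconv
    have := hw ((1 - t) • y + t • w)
    refine le_of_mul_le_mul_left (a := 1 - t) ?_ (by linarith)
    linarith
  have hlim : Tendsto (fun t : ℝ => t * (μ / 2 * ‖y - w‖ ^ 2)) (𝓝[<] 1)
      (𝓝 (1 * (μ / 2 * ‖y - w‖ ^ 2))) :=
    ((continuous_mul_const _).tendsto 1).mono_left nhdsWithin_le_nhds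
  rw [one_mul] at hlim
  exact le_of_tendsto hlim (eventually_of_mem (Ioo_mem_nhdsLT one_pos) hIoo)

/-- Uniform convexity of degree three with constant `c`, in the form: at every point some affine
function supports `g` up to the cube of the distance. It makes minimizing sequences Cauchy, so that
minimizers exist without any compactness. -/
def HasCubicSupport (c : ℝ) (g : E → ℝ) : Prop :=
  ∀ x, ∃ p : E, ∀ y, g x + ⟪p, y - x⟫_ℝ + c * ‖y - x‖ ^ 3 ≤ g y

namespace HasCubicSupport

variable {c : ℝ} {g : E → ℝ}

theorem bddBelow_range (hg : HasCubicSupport c g) (hc : 0 < c) : BddBelow (Set.range g) := by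
  obtain ⟨p, hp⟩ := hg 0
  obtain ⟨B, hB⟩ : ∃ B : ℝ, ∀ r : ℝ, 0 ≤ r → B ≤ c * r ^ 3 - ‖p‖ * r := by
    refine ⟨-(‖p‖ * (1 + ‖p‖ / c)), fun r hr => ?_⟩
    have hpc : 0 ≤ ‖p‖ / c := by positivity
    have hcp : c * (‖p‖ / c) = ‖p‖ := by field_simp
    rcases le_total r (1 + ‖p‖ / c) with h | h
    · have := mul_le_mul_of_nonneg_left h (norm_nonneg p)
      have : 0 ≤ c * r ^ 3 := by positivity
      linarith
    · have hr1 : 1 ≤ r := by linarith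
      have hsq : ‖p‖ ≤ c * r ^ 2 := by
        calc ‖p‖ = c * (‖p‖ / c) := hcp.symm
          _ ≤ c * r := by gcongr; linarith
          _ ≤ c * r ^ 2 := by gcongr; exact le_self_pow₀ hr1 two_ne_zero
      have : 0 ≤ ‖p‖ * (1 + ‖p‖ / c) := by positivity
      nlinarith
  refine ⟨g 0 + B, ?_⟩
  rintro _ ⟨y, rfl⟩
  have hy := hp y
  have hinner := neg_le_of_abs_le (abs_real_inner_le_norm p y)
  have := hB ‖y‖ (norm_nonneg y)
  simp only [sub_zero] at hy
  linarith

theorem norm_sub_cube_le (hg : HasCubicSupport c g) {B : ℝ} (hB : ∀ z, B ≤ g z) (x y : E) :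
    c / 4 * ‖x - y‖ ^ 3 ≤ (g x - B) + (g y - B) := by
  obtain ⟨p, hp⟩ := hg (midpoint ℝ x y)
  have hx := hp x
  have hy := hp y
  have hopp : y - midpoint ℝ x y = -(x - midpoint ℝ x y) := by
    rw [left_sub_midpoint, right_sub_midpoint, ← smul_neg, neg_sub]
  have hnorm : ‖x - midpoint ℝ x y‖ = ‖x - y‖ / 2 := by
    rw [left_sub_midpoint, norm_smul, invOf_eq_inv]
    norm_num
    ring
  rw [hopp, inner_neg_right, norm_neg, hnorm] at hy
  rw [hnorm] at hx
  have := hB (midpoint ℝ x y)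
  linarith

theorem exists_forall_le [CompleteSpace E] (hg : HasCubicSupport c g) (hc : 0 < c)
    (hcont : Continuous g) : ∃ w, ∀ y, g w ≤ g y := by
  have hbdd := hg.bddBelow_range hc
  obtain ⟨u, -, hu, hmem⟩ := exists_seq_tendsto_sInf (Set.range_nonempty g) hbdd
  have hinf : ∀ y, sInf (Set.range g) ≤ g y := fun y => csInf_le hbdd ⟨y, rfl⟩
  choose x hx using hmem
  have hcauchy : CauchySeq x := by
    refine Metric.cauchySeq_iff.2 fun ε hε => ?_
    obtain ⟨N, hN⟩ := eventually_atTop.1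
      (hu.eventually_lt_const (lt_add_of_pos_right _ (show 0 < c / 8 * ε ^ 3 by positivity)))
    refine ⟨N, fun i hi j hj => ?_⟩
    have hij := hg.norm_sub_cube_le hinf (x i) (x j)
    rw [hx, hx] at hij
    have hcube : c * ‖x i - x j‖ ^ 3 < c * ε ^ 3 := by linarith [hN i hi, hN j hj]
    rw [dist_eq_norm]
    exact lt_of_pow_lt_pow_left₀ 3 hε.le (lt_of_mul_lt_mul_left hcube hc.le)
  obtain ⟨w, hw⟩ := cauchySeq_tendsto_of_complete hcauchy
  have hgw : g w = sInf (Set.range g) :=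
    tendsto_nhds_unique ((hcont.tendsto w).comp hw) (hu.congr fun n => (hx n).symm)
  exact ⟨w, fun y => hgw.trans_le (hinf y)⟩

end HasCubicSupport

end Convexity

section NormPower

variable {E : Type*} [NormedAddCommGroup E] [InnerProductSpace ℝ E]

theorem norm_pow_three_add_le (x y : E) :
    ‖x‖ ^ 3 / 3 + ‖x‖ * ⟪x, y - x⟫_ℝ + ‖y - x‖ ^ 3 / 12 ≤ ‖y‖ ^ 3 / 3 := by
  have hsq : ‖y - x‖ ^ 2 = ‖y‖ ^ 2 - 2 * ⟪y, x⟫_ℝ + ‖x‖ ^ 2 := norm_sub_sq_real y x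
  have hinner : ⟪x, y - x⟫_ℝ = (‖y‖ ^ 2 - ‖x‖ ^ 2 - ‖y - x‖ ^ 2) / 2 := by
    rw [inner_sub_right, real_inner_self_eq_norm_sq, real_inner_comm]
    linarith
  have hcube : ‖y - x‖ ^ 3 / 12 ≤
      (‖y‖ - ‖x‖) ^ 2 * (2 * ‖y‖ + ‖x‖) / 6 + ‖x‖ * ‖y - x‖ ^ 2 / 2 := by
    have htri : ‖y - x‖ ≤ ‖y‖ + ‖x‖ := norm_sub_le y x
    rcases le_total (‖y - x‖ / 6) ‖x‖ with h | h
    · have h1 : ‖y - x‖ / 6 * ‖y - x‖ ^ 2 ≤ ‖x‖ * ‖y - x‖ ^ 2 := by gcongr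
      have h2 : 0 ≤ (‖y‖ - ‖x‖) ^ 2 * (2 * ‖y‖ + ‖x‖) := by positivity
      linarith
    · have h1 : (2 * ‖y - x‖ / 3) ^ 2 * (5 * ‖y - x‖ / 3) ≤
          (‖y‖ - ‖x‖) ^ 2 * (2 * ‖y‖ + ‖x‖) := by
        have := norm_nonneg x
        gcongr <;> linarith
      have h2 : 0 ≤ ‖x‖ * ‖y - x‖ ^ 2 := by positivity
      have h3 : 0 ≤ ‖y - x‖ ^ 3 := by positivity
      linarith
  rw [hinner]
  linarith

theorem norm_sub_pow_three_le_inner (x y : E) :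
    ‖y - x‖ ^ 3 / 6 ≤ ⟪‖y‖ • y - ‖x‖ • x, y - x⟫_ℝ := by
  have hxy := norm_pow_three_add_le x y
  have hyx := norm_pow_three_add_le y x
  rw [norm_sub_rev x y, ← neg_sub y x, inner_neg_right] at hyx
  rw [inner_sub_left, real_inner_smul_left, real_inner_smul_left]
  linarith

theorem hasGradientAt_norm_sub_pow_three [CompleteSpace E] (a x : E) :
    HasGradientAt (fun y : E => ‖y - a‖ ^ 3) ((3 * ‖x - a‖) • (x - a)) x := by
  have h := (hasFDerivAt_norm_rpow (x - a) (show (1 : ℝ) < 3 by norm_num)).comp x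
    ((hasFDerivAt_id x).sub_const a)
  rw [hasGradientAt_iff_hasFDerivAt]
  refine (h.congr_of_eventuallyEq (.of_forall fun y => ?_)).congr_fderiv ?_
  · simp only [Function.comp_apply, id_eq]
    norm_cast
  · ext v
    norm_num [real_inner_smul_left]

/-- The derivative of `y ↦ ‖y‖ • y` at `x`, that is, the Hessian of `‖·‖ ^ 3 / 3`. -/
noncomputable def normSmulDeriv (x : E) : E →L[ℝ] E :=
  ‖x‖ • ContinuousLinearMap.id ℝ E + (innerSL ℝ x).smulRight (‖x‖⁻¹ • x)

theorem normSmulDeriv_apply (x h : E) :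
    normSmulDeriv x h = ‖x‖ • h + ⟪x, h⟫_ℝ • ‖x‖⁻¹ • x := by
  simp [normSmulDeriv]

@[simp]
theorem normSmulDeriv_zero : normSmulDeriv (0 : E) = 0 := by
  ext h
  simp [normSmulDeriv_apply]

theorem hasFDerivAt_norm_smul (x : E) :
    HasFDerivAt (fun y : E => ‖y‖ • y) (normSmulDeriv x) x := by
  rcases eq_or_ne x 0 with rfl | hx
  · rw [normSmulDeriv_zero]
    refine HasFDerivAt.of_isLittleO (Asymptotics.isLittleO_iff.2 fun c hc => ?_)
    filter_upwards [Metric.ball_mem_nhds (0 : E) hc] with y hy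
    have hyc : ‖y‖ ≤ c := (mem_ball_zero_iff.1 hy).le
    simpa [norm_smul] using mul_le_mul_of_nonneg_right hyc (norm_nonneg y)
  · have hnorm : HasFDerivAt (fun y : E => ‖y‖) (‖x‖⁻¹ • innerSL ℝ x) x := by
      have hsqrt := (hasStrictFDerivAt_norm_sq x).hasFDerivAt.sqrt
        (pow_ne_zero 2 (norm_ne_zero_iff.2 hx))
      simp only [Real.sqrt_sq (norm_nonneg _)] at hsqrt
      refine hsqrt.congr_fderiv ?_
      ext h
      simp only [one_div, mul_inv_rev, smul_apply, coe_innerSL_apply, nsmul_eq_mul,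
        Nat.cast_ofNat, smul_eq_mul]
      field_simp
    refine (hnorm.smul (hasFDerivAt_id x)).congr_fderiv ?_
    ext h
    simp [normSmulDeriv_apply, smul_smul, mul_comm]

theorem norm_inv_norm_smul_le_one (x : E) : ‖‖x‖⁻¹ • x‖ ≤ 1 := by
  rw [norm_smul, norm_inv, norm_norm]
  exact inv_mul_le_one

theorem norm_mul_norm_inv_norm_smul_sub_le (x y : E) :
    ‖y‖ * ‖‖x‖⁻¹ • x - ‖y‖⁻¹ • y‖ ≤ 2 * ‖x - y‖ := by
  have hcancel : ∀ z : E, ‖z‖ • ‖z‖⁻¹ • z = z := fun z => by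
    rcases eq_or_ne z 0 with rfl | hz
    · simp
    · exact smul_inv_smul₀ (norm_ne_zero_iff.2 hz) z
  have hsplit : ‖y‖ • (‖x‖⁻¹ • x - ‖y‖⁻¹ • y) = (‖y‖ - ‖x‖) • ‖x‖⁻¹ • x + (x - y) := by
    rw [smul_sub, sub_smul, hcancel, hcancel]
    abel
  calc ‖y‖ * ‖‖x‖⁻¹ • x - ‖y‖⁻¹ • y‖ = ‖(‖y‖ - ‖x‖) • ‖x‖⁻¹ • x + (x - y)‖ := by
        rw [← hsplit, norm_smul, norm_norm]
    _ ≤ |‖y‖ - ‖x‖| * ‖‖x‖⁻¹ • x‖ + ‖x - y‖ := by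
        rw [← Real.norm_eq_abs, ← norm_smul]
        exact norm_add_le _ _
    _ ≤ ‖x - y‖ * 1 + ‖x - y‖ := by
        gcongr
        · rw [norm_sub_rev x y]
          exact abs_norm_sub_norm_le y x
        · exact norm_inv_norm_smul_le_one x
    _ = 2 * ‖x - y‖ := by ring

theorem norm_normSmulDeriv_sub_le (x y : E) :
    ‖normSmulDeriv x - normSmulDeriv y‖ ≤ 4 * ‖x - y‖ := by
  refine ContinuousLinearMap.opNorm_le_bound _ (by positivity) fun h => ?_
  have hsplit : (normSmulDeriv x - normSmulDeriv y) h =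
      (‖x‖ - ‖y‖) • h + ⟪x - y, h⟫_ℝ • ‖x‖⁻¹ • x + ⟪y, h⟫_ℝ • (‖x‖⁻¹ • x - ‖y‖⁻¹ • y) := by
    rw [sub_apply, normSmulDeriv_apply, normSmulDeriv_apply, inner_sub_left]
    module
  have h₁ : ‖(‖x‖ - ‖y‖) • h‖ ≤ ‖x - y‖ * ‖h‖ := by
    rw [norm_smul]
    gcongr
    exact abs_norm_sub_norm_le x y
  have h₂ : ‖⟪x - y, h⟫_ℝ • ‖x‖⁻¹ • x‖ ≤ ‖x - y‖ * ‖h‖ := by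
    rw [norm_smul]
    exact (mul_le_of_le_one_right (norm_nonneg _) (norm_inv_norm_smul_le_one x)).trans
      (norm_inner_le_norm _ _)
  have h₃ : ‖⟪y, h⟫_ℝ • (‖x‖⁻¹ • x - ‖y‖⁻¹ • y)‖ ≤ 2 * ‖x - y‖ * ‖h‖ := by
    rw [norm_smul]
    calc _ ≤ (‖y‖ * ‖h‖) * ‖‖x‖⁻¹ • x - ‖y‖⁻¹ • y‖ := by
          gcongr
          exact norm_inner_le_norm _ _
      _ = (‖y‖ * ‖‖x‖⁻¹ • x - ‖y‖⁻¹ • y‖) * ‖h‖ := by ring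
      _ ≤ _ := mul_le_mul_of_nonneg_right (norm_mul_norm_inv_norm_smul_sub_le x y) (norm_nonneg h)
  rw [hsplit]
  exact norm_add₃_le.trans (by linarith)

theorem isPositive_normSmulDeriv (x : E) : (normSmulDeriv x).IsPositive := by
  refine ⟨fun u v => ?_, fun u => ?_⟩
  · simp only [ContinuousLinearMap.coe_coe, normSmulDeriv_apply, inner_add_left, inner_add_right,
      real_inner_smul_left, real_inner_smul_right, real_inner_comm u x]
    ring
  · have hsq : 0 ≤ ‖x‖⁻¹ * (⟪x, u⟫_ℝ * ⟪x, u⟫_ℝ) :=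
      mul_nonneg (by positivity) (mul_self_nonneg _)
    simp only [ContinuousLinearMap.reApplyInnerSelf_apply, RCLike.re_to_real, normSmulDeriv_apply,
      inner_add_left, real_inner_smul_left, real_inner_self_eq_norm_sq]
    rw [mul_left_comm]
    positivity

end NormPower

section CRNModel

variable {E : Type*} [NormedAddCommGroup E] [InnerProductSpace ℝ E] {M : ℝ} {p : E}
  {H : E →L[ℝ] E}

/-- The cubic model whose stationary points are the displacements `z - zbar` of a CRN step with
`p = F zbar`. -/
noncomputable def crnModel (M : ℝ) (p : E) (H : E →L[ℝ] E) (h : E) : ℝ :=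
  ⟪p, h⟫_ℝ + 1 / 2 * ⟪H h, h⟫_ℝ + M / 6 * ‖h‖ ^ 3

theorem hasGradientAt_crnModel [CompleteSpace E] (hH : H.IsPositive) (h : E) :
    HasGradientAt (crnModel M p H) (p + H h + (M / 2 * ‖h‖) • h) h := by
  have hlin : HasFDerivAt (fun h : E => ⟪p, h⟫_ℝ) (innerSL ℝ p) h := (innerSL ℝ p).hasFDerivAt
  have hquad := (H.hasFDerivAt (x := h)).inner ℝ (hasFDerivAt_id h)
  have hcube := (hasGradientAt_norm_sub_pow_three 0 h).hasFDerivAt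
  simp only [sub_zero] at hcube
  rw [hasGradientAt_iff_hasFDerivAt]
  refine ((hlin.add (hquad.const_mul (1 / 2))).add (hcube.const_mul (M / 6))).congr_fderiv ?_
  ext v
  have hsymm : ⟪H v, h⟫_ℝ = ⟪v, H h⟫_ℝ := hH.inner_left_eq_inner_right v h
  simp only [one_div, id_eq, map_smul, map_add, add_apply, smul_apply, coe_innerSL_apply,
    ContinuousLinearMap.comp_apply, ContinuousLinearMap.prod_apply, ContinuousLinearMap.id_apply,
    fderivInnerCLM_apply, real_inner_comm v (H h), hsymm, smul_eq_mul,
    InnerProductSpace.toDual_apply_apply]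
  ring

theorem hasCubicSupport_crnModel (hM : 0 ≤ M) (hH : H.IsPositive) :
    HasCubicSupport (M / 24) (crnModel M p H) := fun x => by
  refine ⟨p + H x + (M / 2 * ‖x‖) • x, fun y => ?_⟩
  have hquad : ⟪H x, x⟫_ℝ + 2 * ⟪H x, y - x⟫_ℝ ≤ ⟪H y, y⟫_ℝ := by
    have hpos := hH.inner_nonneg_left (y - x)
    have hsymm : ⟪H y, x⟫_ℝ = ⟪H x, y⟫_ℝ := by
      rw [hH.inner_left_eq_inner_right, real_inner_comm]
    simp only [map_sub, inner_sub_left, inner_sub_right] at hpos ⊢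
    linarith
  have hcube := mul_le_mul_of_nonneg_left (norm_pow_three_add_le x y) hM
  simp only [crnModel, inner_add_left, inner_sub_right, real_inner_smul_left] at hquad hcube ⊢
  linarith

theorem mul_norm_sub_pow_three_le_inner_crn (hM : 0 ≤ M) (hH : H.IsPositive) (u v : E) :
    M / 12 * ‖v - u‖ ^ 3 ≤
      ⟪(p + H v + (M / 2 * ‖v‖) • v) - (p + H u + (M / 2 * ‖u‖) • u), v - u⟫_ℝ := by
  have hcube := mul_le_mul_of_nonneg_left (norm_sub_pow_three_le_inner u v)
    (show 0 ≤ M / 2 by positivity)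
  have hpos := hH.inner_nonneg_left (v - u)
  have hdiff : (p + H v + (M / 2 * ‖v‖) • v) - (p + H u + (M / 2 * ‖u‖) • u) =
      H (v - u) + (M / 2) • (‖v‖ • v - ‖u‖ • u) := by
    rw [map_sub]
    module
  rw [hdiff, inner_add_left, real_inner_smul_left]
  linarith

theorem crnOracle_nonempty [CompleteSpace E] (hM : 0 < M) (F : E → E) (zbar : E)
    (hH : H.IsPositive) : (crnOracle M F zbar H).Nonempty := by
  have hgrad := fun h => hasGradientAt_crnModel (M := M) (p := F zbar) hH h
  have hcont : Continuous (crnModel M (F zbar) H) :=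
    continuous_iff_continuousAt.2 fun h => (hgrad h).continuousAt
  obtain ⟨w, hw⟩ := (hasCubicSupport_crnModel hM.le hH).exists_forall_le (by positivity) hcont
  refine ⟨zbar + w, ?_⟩
  simpa [crnOracle, (hgrad w).gradient] using gradient_eq_zero_of_forall_le hw

end CRNModel

section Taylor

variable {E F : Type*} [NormedAddCommGroup E] [NormedSpace ℝ E] [NormedAddCommGroup F]
  [NormedSpace ℝ F]

theorem norm_sub_sub_fderiv_le {φ : E → F} {Λ : ℝ} (hφ : Differentiable ℝ φ)
    (hlip : ∀ x y, ‖fderiv ℝ φ x - fderiv ℝ φ y‖ ≤ Λ * ‖x - y‖) (x y : E) :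
    ‖φ y - φ x - fderiv ℝ φ x (y - x)‖ ≤ Λ * ‖y - x‖ ^ 2 := by
  have hsegment : ∀ z ∈ segment ℝ x y, ‖fderiv ℝ φ z - fderiv ℝ φ x‖ ≤ Λ * ‖y - x‖ := by
    rintro z ⟨a, b, ha, hb, hab, rfl⟩
    have hz : a • x + b • y - x = b • (y - x) := by
      rw [eq_sub_of_add_eq hab]
      module
    refine (hlip _ x).trans ?_
    rw [hz, norm_smul, Real.norm_of_nonneg hb, mul_left_comm]
    exact mul_le_of_le_one_left ((norm_nonneg _).trans (hlip y x)) (by linarith)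
  refine ((convex_segment x y).norm_image_sub_le_of_norm_hasFDerivWithin_le'
    (fun z _ => (hφ z).hasFDerivAt.hasFDerivWithinAt) hsegment (left_mem_segment ℝ x y)
    (right_mem_segment ℝ x y)).trans_eq ?_
  ring

end Taylor

section Hessian

variable {E : Type*} [NormedAddCommGroup E] [InnerProductSpace ℝ E] [CompleteSpace E]
  {f : E → ℝ}

theorem differentiable_gradient (hf : ContDiff ℝ 2 f) : Differentiable ℝ (gradient f) :=
  (InnerProductSpace.toDual ℝ E).symm.toContinuousLinearEquiv.differentiable.comp
    ((hf.fderiv_right (m := 1) (by norm_num)).differentiable (by norm_num))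

theorem inner_hess_eq_fderiv_fderiv (hf : ContDiff ℝ 2 f) (z u v : E) :
    ⟪hess f z u, v⟫_ℝ = fderiv ℝ (fderiv ℝ f) z u v := by
  have hfderiv : DifferentiableAt ℝ (fderiv ℝ f) z :=
    (hf.fderiv_right (m := 1) (by norm_num)).differentiable (by norm_num) z
  have hinner : HasFDerivAt (fun x => ⟪v, gradient f x⟫_ℝ) ((innerSL ℝ v).comp (hess f z)) z :=
    (innerSL ℝ v).hasFDerivAt.comp z (differentiable_gradient hf z).hasFDerivAt
  have happly : HasFDerivAt (fun x => fderiv ℝ f x v) ((fderiv ℝ (fderiv ℝ f) z).flip v) z := by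
    simpa using hfderiv.hasFDerivAt.clm_apply (hasFDerivAt_const v z)
  simp only [← inner_gradient_left, real_inner_comm v] at happly
  rw [real_inner_comm]
  exact congrArg (fun φ => φ u) (hinner.unique happly)

theorem isSymmetric_hess (hf : ContDiff ℝ 2 f) (z : E) :
    (hess f z : E →ₗ[ℝ] E).IsSymmetric := fun u v => by
  rw [ContinuousLinearMap.coe_coe, ← real_inner_comm u, inner_hess_eq_fderiv_fderiv hf,
    inner_hess_eq_fderiv_fderiv hf]
  exact (hf.contDiffAt.isSymmSndFDerivAt (by simp)) u v

theorem inner_hess_self_nonneg (hf : ContDiff ℝ 2 f) (hc : ConvexOn ℝ Set.univ f) (z u : E) :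
    0 ≤ ⟪hess f z u, u⟫_ℝ := by
  have hline : HasDerivAt (fun t : ℝ => z + t • u) u 0 := by
    simpa using ((hasDerivAt_id (0 : ℝ)).smul_const u).const_add z
  have hhess : HasFDerivAt (gradient f) (hess f z) (z + (0 : ℝ) • u) := by
    rw [zero_smul, add_zero]
    exact (differentiable_gradient hf z).hasFDerivAt
  have hderiv : HasDerivAt (fun t : ℝ => ⟪gradient f (z + t • u), u⟫_ℝ) ⟪hess f z u, u⟫_ℝ 0 := by
    simpa using (hhess.comp_hasDerivAt (0 : ℝ) hline).inner ℝ (hasDerivAt_const (0 : ℝ) u)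
  have hmono : Monotone (fun t : ℝ => ⟪gradient f (z + t • u), u⟫_ℝ) := by
    refine monotone_iff_forall_lt.2 fun s t hst => ?_
    have h := inner_gradient_sub_nonneg_of_convexOn hc (hf.differentiable (by norm_num))
      (z + s • u) (z + t • u)
    rw [show z + t • u - (z + s • u) = (t - s) • u by module, real_inner_smul_right,
      inner_sub_left] at h
    exact sub_nonneg.1 (nonneg_of_mul_nonneg_right h (sub_pos.2 hst))
  rw [← hderiv.deriv]
  exact hmono.deriv_nonneg

theorem isPositive_hess (hf : ContDiff ℝ 2 f) (hc : ConvexOn ℝ Set.univ f) (z : E) :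
    (hess f z).IsPositive :=
  ⟨isSymmetric_hess hf z, inner_hess_self_nonneg hf hc z⟩

end Hessian

section Prox

variable {E : Type*} [NormedAddCommGroup E] [InnerProductSpace ℝ E] [CompleteSpace E]
  {f : E → ℝ} {L γ : ℝ}

theorem gradient_proxFun (hf : Differentiable ℝ f) (γ : ℝ) (zbar : E) :
    gradient (proxFun f γ zbar) = fun z => gradient f z + γ • ‖z - zbar‖ • (z - zbar) := by
  refine gradient_eq fun z => ?_
  have hcube := (hasGradientAt_norm_sub_pow_three zbar z).hasFDerivAt.const_mul (γ / 3)
  rw [hasGradientAt_iff_hasFDerivAt]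
  refine ((hf z).hasGradientAt.hasFDerivAt.add hcube).congr_fderiv ?_
  rw [map_add, map_smul, map_smul, map_smul, smul_smul, smul_smul]
  congr 2
  ring

theorem hasFDerivAt_gradient_proxFun (hf : ContDiff ℝ 2 f) (γ : ℝ) (zbar z : E) :
    HasFDerivAt (gradient (proxFun f γ zbar)) (hess f z + γ • normSmulDeriv (z - zbar)) z := by
  rw [gradient_proxFun (hf.differentiable (by norm_num))]
  have hcube : HasFDerivAt (fun z : E => ‖z - zbar‖ • (z - zbar)) (normSmulDeriv (z - zbar)) z :=
    (hasFDerivAt_comp_sub zbar).2 (hasFDerivAt_norm_smul (z - zbar))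
  exact (differentiable_gradient hf z).hasFDerivAt.add (hcube.const_smul γ)

theorem hess_proxFun (hf : ContDiff ℝ 2 f) (γ : ℝ) (zbar z : E) :
    hess (proxFun f γ zbar) z = hess f z + γ • normSmulDeriv (z - zbar) :=
  (hasFDerivAt_gradient_proxFun hf γ zbar z).fderiv

/-- The hypotheses under which the lazy Newton method is analysed: `g` is uniformly convex of degree
three with parameter `γ`, and its Hessian is positive semidefinite and `Λ`-Lipschitz. The proximal
functions `proxFun f γ zbar` are the intended instances; they need not be `C ^ 3`. -/
structure CubicallyConvex (γ Λ : ℝ) (g : E → ℝ) : Prop where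
  differentiable : Differentiable ℝ g
  differentiable_gradient : Differentiable ℝ (gradient g)
  add_inner_gradient_le : ∀ x y : E,
    g x + ⟪gradient g x, y - x⟫_ℝ + γ / 12 * ‖y - x‖ ^ 3 ≤ g y
  norm_hess_sub_le : ∀ x y : E, ‖hess g x - hess g y‖ ≤ Λ * ‖x - y‖
  isPositive_hess : ∀ x : E, (hess g x).IsPositive

theorem norm_hess_proxFun_sub_le (hγ : 0 ≤ γ) (hf : HasLipschitzHessian L f) (zbar x y : E) :
    ‖hess (proxFun f γ zbar) x - hess (proxFun f γ zbar) y‖ ≤ (L + 4 * γ) * ‖x - y‖ := by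
  have hcube := norm_normSmulDeriv_sub_le (x - zbar) (y - zbar)
  rw [sub_sub_sub_cancel_right] at hcube
  rw [hess_proxFun hf.1, hess_proxFun hf.1, add_sub_add_comm, ← smul_sub]
  calc _ ≤ ‖hess f x - hess f y‖ + γ * ‖normSmulDeriv (x - zbar) - normSmulDeriv (y - zbar)‖ := by
        refine (norm_add_le _ _).trans_eq ?_
        rw [norm_smul, Real.norm_of_nonneg hγ]
    _ ≤ L * ‖x - y‖ + γ * (4 * ‖x - y‖) := by
        gcongr
        exact hf.2 x y
    _ = _ := by ring

theorem proxFun_add_inner_gradient_le (hγ : 0 ≤ γ) (hf : Differentiable ℝ f)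
    (hc : ConvexOn ℝ Set.univ f) (zbar x y : E) :
    proxFun f γ zbar x + ⟪gradient (proxFun f γ zbar) x, y - x⟫_ℝ + γ / 12 * ‖y - x‖ ^ 3 ≤
      proxFun f γ zbar y := by
  have hconv := add_inner_gradient_le_of_convexOn hc (hf x) y
  have hcube := mul_le_mul_of_nonneg_left (norm_pow_three_add_le (x - zbar) (y - zbar)) hγ
  rw [sub_sub_sub_cancel_right] at hcube
  rw [gradient_proxFun hf, inner_add_left, real_inner_smul_left, real_inner_smul_left]
  simp only [proxFun]
  linarith

theorem cubicallyConvex_proxFun (hγ : 0 ≤ γ) (hf : HasLipschitzHessian L f)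
    (hc : ConvexOn ℝ Set.univ f) (zbar : E) :
    CubicallyConvex γ (L + 4 * γ) (proxFun f γ zbar) where
  differentiable := (hf.1.differentiable (by norm_num)).add fun z =>
    ((hasGradientAt_norm_sub_pow_three zbar z).differentiableAt.const_mul (γ / 3))
  differentiable_gradient z := (hasFDerivAt_gradient_proxFun hf.1 γ zbar z).differentiableAt
  add_inner_gradient_le :=
    proxFun_add_inner_gradient_le hγ (hf.1.differentiable (by norm_num)) hc zbar
  norm_hess_sub_le := norm_hess_proxFun_sub_le hγ hf zbar
  isPositive_hess z := by
    rw [hess_proxFun hf.1]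
    exact (isPositive_hess hf.1 hc z).add ((isPositive_normSmulDeriv _).smul_of_nonneg hγ)

end Prox

section CRNStep

variable {E : Type*} [NormedAddCommGroup E] [InnerProductSpace ℝ E] [CompleteSpace E]
  {g : E → ℝ} {γ Λ M : ℝ} {w x y z : E}

namespace CubicallyConvex

theorem gradient_taylor (hg : CubicallyConvex γ Λ g) (x y : E) :
    ‖gradient g y - gradient g x - hess g x (y - x)‖ ≤ Λ * ‖y - x‖ ^ 2 :=
  norm_sub_sub_fderiv_le hg.differentiable_gradient hg.norm_hess_sub_le x y

theorem exists_forall_le (hg : CubicallyConvex γ Λ g) (hγ : 0 < γ) : ∃ w, ∀ z, g w ≤ g z :=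
  HasCubicSupport.exists_forall_le (c := γ / 12)
    (fun x => ⟨gradient g x, hg.add_inner_gradient_le x⟩) (by positivity)
    hg.differentiable.continuous

theorem sub_le_inner (hg : CubicallyConvex γ Λ g) (hγ : 0 ≤ γ) (x y : E) :
    g y - g x ≤ ⟪gradient g y, y - x⟫_ℝ := by
  have h := hg.add_inner_gradient_le y x
  rw [← neg_sub y x, inner_neg_right, norm_neg] at h
  have : 0 ≤ γ / 12 * ‖y - x‖ ^ 3 := by positivity
  linarith

theorem mul_norm_sub_pow_three_le_sub (hg : CubicallyConvex γ Λ g) (hw : ∀ z, g w ≤ g z) (y : E) :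
    γ / 12 * ‖y - w‖ ^ 3 ≤ g y - g w := by
  have h := hg.add_inner_gradient_le w y
  rw [gradient_eq_zero_of_forall_le hw, inner_zero_left] at h
  linarith

theorem mul_norm_sub_sq_le_norm_gradient (hg : CubicallyConvex γ Λ g) (hw : ∀ z, g w ≤ g z)
    (y : E) : γ / 6 * ‖y - w‖ ^ 2 ≤ ‖gradient g y‖ := by
  rcases (norm_nonneg (y - w)).eq_or_lt with h0 | h0
  · rw [← h0]
    simp
  have hinner : γ / 6 * ‖y - w‖ ^ 3 ≤ ⟪gradient g y, y - w⟫_ℝ := by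
    have h := hg.add_inner_gradient_le y w
    rw [← neg_sub y w, inner_neg_right, norm_neg] at h
    have := hg.mul_norm_sub_pow_three_le_sub hw y
    linarith
  refine le_of_mul_le_mul_right ?_ h0
  calc γ / 6 * ‖y - w‖ ^ 2 * ‖y - w‖ = γ / 6 * ‖y - w‖ ^ 3 := by ring
    _ ≤ ‖gradient g y‖ * ‖y - w‖ := hinner.trans (real_inner_le_norm _ _)

theorem mul_sub_sq_le_norm_gradient_pow_three (hg : CubicallyConvex γ Λ g) (hγ : 0 ≤ γ)
    (hw : ∀ z, g w ≤ g z) (y : E) : γ * (g y - g w) ^ 2 ≤ 6 * ‖gradient g y‖ ^ 3 := by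
  have hgap : g y - g w ≤ ‖gradient g y‖ * ‖y - w‖ :=
    (hg.sub_le_inner hγ w y).trans (real_inner_le_norm _ _)
  have h0 : 0 ≤ g y - g w := sub_nonneg.2 (hw y)
  calc γ * (g y - g w) ^ 2 ≤ γ * (‖gradient g y‖ * ‖y - w‖) ^ 2 := by gcongr
    _ = 6 * ‖gradient g y‖ ^ 2 * (γ / 6 * ‖y - w‖ ^ 2) := by ring
    _ ≤ 6 * ‖gradient g y‖ ^ 2 * ‖gradient g y‖ := by
        gcongr
        exact hg.mul_norm_sub_sq_le_norm_gradient hw y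
    _ = 6 * ‖gradient g y‖ ^ 3 := by ring

theorem le_average (hg : CubicallyConvex γ Λ g) (hγ : 0 ≤ γ) {m : ℕ} (hm : m ≠ 0) (z : ℕ → E) :
    m * g ((1 / (m : ℝ)) • ∑ t ∈ Finset.range m, z t) ≤ ∑ t ∈ Finset.range m, g (z t) := by
  set a := (1 / (m : ℝ)) • ∑ t ∈ Finset.range m, z t with ha
  have hcentred : ∑ t ∈ Finset.range m, (z t - a) = 0 := by
    rw [Finset.sum_sub_distrib, Finset.sum_const, Finset.card_range, ha,
      ← Nat.cast_smul_eq_nsmul ℝ, smul_smul, mul_one_div_cancel (Nat.cast_ne_zero.2 hm), one_smul,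
      sub_self]
  calc m * g a = ∑ t ∈ Finset.range m, (g a + ⟪gradient g a, z t - a⟫_ℝ) := by
        rw [Finset.sum_add_distrib, ← inner_sum, hcentred, inner_zero_right, Finset.sum_const,
          Finset.card_range, nsmul_eq_mul, add_zero]
    _ ≤ ∑ t ∈ Finset.range m, g (z t) := by
        refine Finset.sum_le_sum fun t _ => ?_
        have := hg.add_inner_gradient_le a (z t)
        have : 0 ≤ γ / 12 * ‖z t - a‖ ^ 3 := by positivity
        linarith

theorem crnStep_mem_crnOracle (hg : CubicallyConvex γ Λ g) (hM : 0 < M) (x z : E) :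
    crnStep M (gradient g) z (hess g x) ∈ crnOracle M (gradient g) z (hess g x) := by
  have h := crnOracle_nonempty hM (gradient g) z (hg.isPositive_hess x)
  rw [crnStep, dif_pos h]
  exact h.some_mem

theorem norm_gradient_add_le_of_mem_crnOracle (hg : CubicallyConvex γ Λ g)
    (hy : y ∈ crnOracle M (gradient g) z (hess g x)) :
    ‖gradient g y + (M / 2 * ‖y - z‖) • (y - z)‖ ≤
      Λ * (‖y - z‖ + ‖z - x‖) * ‖y - z‖ := by
  have hstep : gradient g z + hess g x (y - z) + (M / 2 * ‖y - z‖) • (y - z) = 0 := hy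
  have hsplit : gradient g y + (M / 2 * ‖y - z‖) • (y - z) =
      (gradient g y - gradient g z - hess g z (y - z)) + (hess g z - hess g x) (y - z) := by
    rw [← sub_zero (gradient g y + _), ← hstep, sub_apply]
    abel
  have hlazy : ‖(hess g z - hess g x) (y - z)‖ ≤ Λ * ‖z - x‖ * ‖y - z‖ :=
    ((hess g z - hess g x).le_opNorm _).trans
      (mul_le_mul_of_nonneg_right (hg.norm_hess_sub_le z x) (norm_nonneg _))
  calc _ ≤ Λ * ‖y - z‖ ^ 2 + Λ * ‖z - x‖ * ‖y - z‖ := by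
        rw [hsplit]
        exact (norm_add_le _ _).trans (add_le_add (hg.gradient_taylor z y) hlazy)
    _ = _ := by ring

theorem norm_gradient_le_of_mem_crnOracle (hg : CubicallyConvex γ Λ g) (hM : 0 ≤ M)
    (hy : y ∈ crnOracle M (gradient g) z (hess g x)) :
    ‖gradient g y‖ ≤ (Λ * (‖y - z‖ + ‖z - x‖) + M / 2 * ‖y - z‖) * ‖y - z‖ := by
  have h := norm_sub_le (gradient g y + (M / 2 * ‖y - z‖) • (y - z)) ((M / 2 * ‖y - z‖) • (y - z))
  rw [add_sub_cancel_right, norm_smul, Real.norm_of_nonneg (by positivity)] at h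
  have := hg.norm_gradient_add_le_of_mem_crnOracle hy
  linarith

theorem le_sub_of_mem_crnOracle (hg : CubicallyConvex γ Λ g) (hγ : 0 ≤ γ)
    (hy : y ∈ crnOracle M (gradient g) z (hess g x)) :
    g y ≤ g z - (M / 2 - Λ) * ‖y - z‖ ^ 3 + Λ * (‖z - x‖ * ‖y - z‖ ^ 2) := by
  have hconv := hg.sub_le_inner hγ z y
  have hinner := real_inner_le_norm (gradient g y + (M / 2 * ‖y - z‖) • (y - z)) (y - z)
  rw [inner_add_left, real_inner_smul_left, real_inner_self_eq_norm_sq] at hinner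
  have := mul_le_mul_of_nonneg_right (hg.norm_gradient_add_le_of_mem_crnOracle hy)
    (norm_nonneg (y - z))
  linarith

theorem mul_norm_sub_sq_le_of_mem_crnOracle (hg : CubicallyConvex γ Λ g) (hM : 0 ≤ M)
    (hw : ∀ z, g w ≤ g z) (hy : y ∈ crnOracle M (gradient g) z (hess g z)) :
    M / 12 * ‖y - w‖ ^ 2 ≤ (Λ + M / 2) * ‖z - w‖ ^ 2 := by
  have hstep : gradient g z + hess g z (y - z) + (M / 2 * ‖y - z‖) • (y - z) = 0 := hy
  rw [norm_sub_rev y w, norm_sub_rev z w]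
  rcases (norm_nonneg (w - y)).eq_or_lt with h0 | h0
  · have := (norm_nonneg _).trans (hg.gradient_taylor z w)
    have : 0 ≤ M / 2 * ‖w - z‖ ^ 2 := by positivity
    rw [← h0]
    linarith
  set G := gradient g z + hess g z (w - z) + (M / 2 * ‖w - z‖) • (w - z)
  have hnorm : ‖G‖ ≤ (Λ + M / 2) * ‖w - z‖ ^ 2 := by
    have ht := hg.gradient_taylor z w
    rw [gradient_eq_zero_of_forall_le hw, zero_sub, ← neg_add', norm_neg] at ht
    refine (norm_add_le _ _).trans ?_
    rw [norm_smul, Real.norm_of_nonneg (by positivity)]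
    linarith
  have hmono : M / 12 * ‖w - y‖ ^ 3 ≤ ⟪G, w - y⟫_ℝ := by
    have h := mul_norm_sub_pow_three_le_inner_crn (p := gradient g z) hM (hg.isPositive_hess z)
      (y - z) (w - z)
    rwa [hstep, sub_zero, sub_sub_sub_cancel_right] at h
  refine le_of_mul_le_mul_right ?_ h0
  calc M / 12 * ‖w - y‖ ^ 2 * ‖w - y‖ = M / 12 * ‖w - y‖ ^ 3 := by ring
    _ ≤ ‖G‖ * ‖w - y‖ := hmono.trans (real_inner_le_norm _ _)
    _ ≤ (Λ + M / 2) * ‖w - z‖ ^ 2 * ‖w - y‖ := by gcongr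

section FullStep

variable {L : ℝ} (hg : CubicallyConvex γ Λ g) (hL : 0 < L) (hΛ : Λ ≤ 5 * L)
  (hw : ∀ z, g w ≤ g z) (hy : y ∈ crnOracle L (gradient g) z (hess g z))
include hg hL hΛ hw hy

theorem norm_sub_minimizer_le_of_mem_crnOracle : ‖y - w‖ ≤ 9 * ‖z - w‖ := by
  refine le_of_sq_le_sq ?_ (by positivity)
  refine le_of_mul_le_mul_left ?_ hL
  have hdist := hg.mul_norm_sub_sq_le_of_mem_crnOracle hL.le hw hy
  have := mul_le_mul_of_nonneg_right hΛ (sq_nonneg ‖z - w‖)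
  have := mul_nonneg hL.le (sq_nonneg ‖z - w‖)
  linarith

theorem norm_gradient_le_norm_sub_minimizer_sq : ‖gradient g y‖ ≤ 550 * L * ‖z - w‖ ^ 2 := by
  have hyz : ‖y - z‖ ≤ 10 * ‖z - w‖ := by
    have := norm_sub_le (y - w) (z - w)
    rw [sub_sub_sub_cancel_right] at this
    linarith [hg.norm_sub_minimizer_le_of_mem_crnOracle hL hΛ hw hy]
  calc ‖gradient g y‖ ≤ (Λ * (‖y - z‖ + ‖z - z‖) + L / 2 * ‖y - z‖) * ‖y - z‖ :=
        hg.norm_gradient_le_of_mem_crnOracle hL.le hy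
    _ = (Λ + L / 2) * ‖y - z‖ ^ 2 := by
        rw [sub_self, norm_zero]
        ring
    _ ≤ (5 * L + L / 2) * (10 * ‖z - w‖) ^ 2 := by gcongr
    _ = 550 * L * ‖z - w‖ ^ 2 := by ring

theorem sub_min_le_norm_sub_minimizer_pow_three (hγ : 0 ≤ γ) :
    g y - g w ≤ 5000 * L * ‖z - w‖ ^ 3 := by
  calc g y - g w ≤ ‖gradient g y‖ * ‖y - w‖ :=
        (hg.sub_le_inner hγ w y).trans (real_inner_le_norm _ _)
    _ ≤ 550 * L * ‖z - w‖ ^ 2 * (9 * ‖z - w‖) := by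
        gcongr
        · exact hg.norm_gradient_le_norm_sub_minimizer_sq hL hΛ hw hy
        · exact hg.norm_sub_minimizer_le_of_mem_crnOracle hL hΛ hw hy
    _ ≤ 5000 * L * ‖z - w‖ ^ 3 := by
        have : 0 ≤ L * ‖z - w‖ ^ 3 := by positivity
        linarith

end FullStep

end CubicallyConvex

end CRNStep

section RealSequences

variable {r S : ℕ → ℝ} {k m : ℕ}

theorem sum_mul_sq_le_of_le_sum (hr : ∀ t, 0 ≤ r t)
    (hS : ∀ t, S t ≤ ∑ i ∈ Finset.range t, r i) (k : ℕ) :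
    ∑ t ∈ Finset.range k, S t * r t ^ 2 ≤
      2 / 3 * ((k : ℝ) - 1) * ∑ t ∈ Finset.range k, r t ^ 3 := by
  induction k with
  | zero => simp
  | succ k ih =>
    have hlast : S k * r k ^ 2 ≤ (∑ t ∈ Finset.range k, r t ^ 3) / 3 + 2 / 3 * k * r k ^ 3 := by
      calc S k * r k ^ 2 ≤ (∑ i ∈ Finset.range k, r i) * r k ^ 2 := by
            gcongr
            exact hS k
        _ = ∑ i ∈ Finset.range k, r i * r k ^ 2 := Finset.sum_mul _ _ _
        _ ≤ ∑ i ∈ Finset.range k, (r i ^ 3 / 3 + 2 / 3 * r k ^ 3) := by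
            refine Finset.sum_le_sum fun i _ => ?_
            nlinarith [mul_nonneg (sq_nonneg (r i - r k)) (hr i),
              mul_nonneg (sq_nonneg (r i - r k)) (hr k)]
        _ = _ := by
            rw [Finset.sum_add_distrib, ← Finset.sum_div, Finset.sum_const, Finset.card_range,
              nsmul_eq_mul]
            ring
    have hsum : 0 ≤ ∑ t ∈ Finset.range k, r t ^ 3 :=
      Finset.sum_nonneg fun i _ => pow_nonneg (hr i) 3
    rw [Finset.sum_range_succ, Finset.sum_range_succ]
    push_cast
    linarith

theorem sum_pow_three_le_sq_mul_sum (hr : ∀ t, 0 ≤ r t) (hk : k ≤ m) :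
    (∑ i ∈ Finset.range k, r i) ^ 3 ≤ (m : ℝ) ^ 2 * ∑ i ∈ Finset.range k, r i ^ 3 := by
  have hsum : 0 ≤ ∑ i ∈ Finset.range k, r i ^ 3 := Finset.sum_nonneg fun i _ => pow_nonneg (hr i) 3
  rcases Nat.eq_zero_or_pos k with rfl | hk0
  · simp
  have h := pow_sum_div_card_le_sum_pow (s := Finset.range k) (fun i _ => hr i) 2
  rw [Finset.card_range, div_le_iff₀ (by positivity), mul_comm] at h
  calc _ ≤ (k : ℝ) ^ 2 * ∑ i ∈ Finset.range k, r i ^ 3 := h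
    _ ≤ (m : ℝ) ^ 2 * ∑ i ∈ Finset.range k, r i ^ 3 := by gcongr

theorem sum_add_div_pow_three_le (hr : ∀ t, 0 ≤ r t) (hS0 : ∀ t, 0 ≤ S t)
    (hS : ∀ t, S t ≤ ∑ i ∈ Finset.range t, r i) (hm : 1 ≤ m) (hk : k ≤ m) :
    ∑ t ∈ Finset.range k, (r t + S t / m) ^ 3 ≤ 8 * ∑ t ∈ Finset.range k, r t ^ 3 := by
  have hm0 : (0 : ℝ) < m := by exact_mod_cast hm
  set R := ∑ t ∈ Finset.range k, r t ^ 3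
  have hR : 0 ≤ R := Finset.sum_nonneg fun i _ => pow_nonneg (hr i) 3
  have hterm : ∀ t ∈ Finset.range k, (r t + S t / m) ^ 3 ≤ 4 * r t ^ 3 + 4 * (R / m) := by
    intro t ht
    have hpath : S t ≤ ∑ i ∈ Finset.range k, r i :=
      (hS t).trans (Finset.sum_le_sum_of_subset_of_nonneg
        (Finset.range_mono (Finset.mem_range.1 ht).le) fun i _ _ => hr i)
    have hS3 : (S t / m) ^ 3 ≤ R / m := by
      have := (pow_le_pow_left₀ (hS0 t) hpath 3).trans (sum_pow_three_le_sq_mul_sum hr hk)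
      rw [div_pow, div_le_div_iff₀ (by positivity) hm0]
      nlinarith
    linarith [add_pow_le (hr t) (div_nonneg (hS0 t) hm0.le) 3]
  calc _ ≤ ∑ t ∈ Finset.range k, (4 * r t ^ 3 + 4 * (R / m)) := Finset.sum_le_sum hterm
    _ = 4 * R + 4 * ((k : ℝ) / m * R) := by
        rw [Finset.sum_add_distrib, ← Finset.mul_sum, Finset.sum_const, Finset.card_range,
          nsmul_eq_mul]
        ring
    _ ≤ 8 * R := by
        have : (k : ℝ) / m ≤ 1 := (div_le_one hm0).2 (by exact_mod_cast hk)
        nlinarith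

theorem sum_le_mul_of_sum_le_mul_sub {δ : ℕ → ℝ} {C : ℝ} (hC : 0 ≤ C) (hm : 1 ≤ m) (h0 : 0 ≤ δ 0)
    (h : ∀ k ≤ m, ∑ t ∈ Finset.range k, δ (t + 1) ≤ C * m * (δ 0 - δ k)) :
    ∑ t ∈ Finset.range m, δ (t + 1) ≤ m * ((1 - 1 / (2 * C + 1)) * δ 0) := by
  have hm0 : (0 : ℝ) < m := by exact_mod_cast hm
  set q := 1 / (2 * C + 1) with hq
  have hqC : 1 - q = 2 * C * q := by
    rw [hq]
    field_simp
    ring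
  have hq0 : 0 ≤ q := by positivity
  have key : ∀ k ≤ m, ∑ t ∈ Finset.range k, δ (t + 1) ≤ δ 0 * (k - q * (k ^ 2 / m)) := by
    intro k
    induction k with
    | zero => simp
    | succ k ih =>
      intro hk
      have hdec := h (k + 1) hk
      have ih := ih (by omega)
      rw [Finset.sum_range_succ] at hdec ⊢
      have hsq : ((k : ℝ) + 1) ^ 2 / m ≤ k + 1 := by
        have : (k : ℝ) + 1 ≤ m := by exact_mod_cast hk
        rw [div_le_iff₀ hm0]
        nlinarith
      set P := ∑ t ∈ Finset.range k, δ (t + 1)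
      refine le_of_mul_le_mul_left (a := C * m + 1) ?_ (by positivity)
      have hmargin : 0 ≤ δ 0 * (k + 1 - q * C * (2 * k + 1) - q * (((k : ℝ) + 1) ^ 2 / m)) := by
        refine mul_nonneg h0 ?_
        have := mul_le_mul_of_nonneg_left hsq hq0
        have : 0 ≤ q * C := by positivity
        have : ((k : ℝ) + 1) * (1 - q) = (k + 1) * (2 * C * q) := by rw [hqC]
        linarith
      calc (C * m + 1) * (P + δ (k + 1)) ≤ C * m * (P + δ 0) := by linarith
        _ ≤ C * m * (δ 0 * (k - q * (k ^ 2 / m)) + δ 0) := by gcongr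
        _ = (C * m + 1) * (δ 0 * ((k + 1) - q * ((k + 1) ^ 2 / m))) -
              δ 0 * (k + 1 - q * C * (2 * k + 1) - q * ((k + 1) ^ 2 / m)) := by
            field_simp
            ring
        _ ≤ (C * m + 1) * (δ 0 * ((k + 1 : ℕ) - q * ((k + 1 : ℕ) ^ 2 / m))) := by
            push_cast
            linarith
  refine (key m le_rfl).trans (le_of_eq ?_)
  field_simp

theorem one_sub_pow_ceil_div_le {q a p K M : ℝ} (hq0 : 0 ≤ q) (hq1 : q ≤ 1) (hM : 0 < M)
    (hK : (a + p * Real.log M) * M ≤ q * K) :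
    (1 - q) ^ ⌈K / M⌉₊ ≤ Real.exp (-a) * M ^ (-p) := by
  have hceil : a + p * Real.log M ≤ ⌈K / M⌉₊ * q := by
    calc a + p * Real.log M ≤ K / M * q := by
          rw [div_mul_eq_mul_div, le_div_iff₀ hM]
          linarith
      _ ≤ ⌈K / M⌉₊ * q := by
          gcongr
          exact Nat.le_ceil _
  calc (1 - q) ^ ⌈K / M⌉₊ ≤ Real.exp (-q) ^ ⌈K / M⌉₊ :=
        pow_le_pow_left₀ (by linarith) (Real.one_sub_le_exp_neg q) _
    _ = Real.exp (-(⌈K / M⌉₊ * q)) := by rw [← Real.exp_nat_mul, mul_neg]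
    _ ≤ Real.exp (-a + Real.log M * -p) := Real.exp_le_exp.2 (by linarith)
    _ = Real.exp (-a) * M ^ (-p) := by rw [Real.exp_add, Real.rpow_def_of_pos hM]

end RealSequences

section LazyEpoch

variable {E : Type*} [NormedAddCommGroup E] [InnerProductSpace ℝ E] [CompleteSpace E]
  {g : E → ℝ} {γ Λ M : ℝ} {m : ℕ} {w : E}

theorem norm_lazyIterate_sub_le (g : E → ℝ) (M : ℝ) (zs : E) (t : ℕ) :
    ‖lazyIterate g M zs t - zs‖ ≤
      ∑ i ∈ Finset.range t, ‖lazyIterate g M zs (i + 1) - lazyIterate g M zs i‖ := by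
  calc _ = ‖∑ i ∈ Finset.range t, (lazyIterate g M zs (i + 1) - lazyIterate g M zs i)‖ := by
        rw [Finset.sum_range_sub, lazyIterate.eq_1]
    _ ≤ _ := norm_sum_le _ _

theorem lazyEpoch_eq_sum_range (g : E → ℝ) (M : ℝ) (m : ℕ) (zs : E) :
    lazyEpoch g M m zs = (1 / (m : ℝ)) • ∑ t ∈ Finset.range m, lazyIterate g M zs (t + 1) := by
  rw [lazyEpoch, Finset.range_eq_Ico, Finset.sum_Ico_add']
  rfl

namespace CubicallyConvex

variable (hg : CubicallyConvex γ Λ g) (hγ : 0 < γ) (hM : 0 < M) (hΛ : 0 ≤ Λ) (hm : 1 ≤ m)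
  (hΛM : 3 * m * Λ ≤ M) (hMγ : M ≤ 18 * m ^ 2 * γ) (hw : ∀ z, g w ≤ g z)

include hg hM hΛ hm hΛM in
theorem norm_gradient_lazyIterate_succ_le (zs : E) (t : ℕ) :
    ‖gradient g (lazyIterate g M zs (t + 1))‖ ≤ 5 / 6 * M *
      (‖lazyIterate g M zs (t + 1) - lazyIterate g M zs t‖ +
        ‖lazyIterate g M zs t - zs‖ / m) ^ 2 := by
  have hm1 : (1 : ℝ) ≤ m := by exact_mod_cast hm
  have hgrad := hg.norm_gradient_le_of_mem_crnOracle hM.le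
    (hg.crnStep_mem_crnOracle hM zs (lazyIterate g M zs t))
  rw [← lazyIterate] at hgrad
  set r := ‖lazyIterate g M zs (t + 1) - lazyIterate g M zs t‖
  set s := ‖lazyIterate g M zs t - zs‖
  have hs : 0 ≤ s / m := by positivity
  have hs' : s = m * (s / m) := by field_simp
  have hΛr : Λ * r ≤ M / 3 * r := by
    gcongr
    nlinarith
  have hΛs : Λ * s ≤ M / 3 * (s / m) := by
    rw [hs', mul_div_cancel_left₀ _ (by positivity)]
    nlinarith
  calc _ ≤ (Λ * (r + s) + M / 2 * r) * r := hgrad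
    _ ≤ (5 / 6 * M * (r + s / m)) * (r + s / m) := by
        gcongr ?_ * ?_
        · have : 0 ≤ M * (s / m) := by positivity
          linarith
        · linarith
    _ = _ := by ring

include hg hγ hM hΛ hm hΛM hMγ hw in
theorem sub_min_lazyIterate_succ_le (zs : E) (t : ℕ) :
    g (lazyIterate g M zs (t + 1)) - g w ≤ 8 * m * M *
      (‖lazyIterate g M zs (t + 1) - lazyIterate g M zs t‖ +
        ‖lazyIterate g M zs t - zs‖ / m) ^ 3 := by
  have hgrad := hg.norm_gradient_lazyIterate_succ_le hM hΛ hm hΛM zs t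
  have hgap := hg.mul_sub_sq_le_norm_gradient_pow_three hγ.le hw (lazyIterate g M zs (t + 1))
  set x := ‖lazyIterate g M zs (t + 1) - lazyIterate g M zs t‖ + ‖lazyIterate g M zs t - zs‖ / m
  refine le_of_sq_le_sq (le_of_mul_le_mul_left ?_ hγ) (by positivity)
  calc _ ≤ 6 * (5 / 6 * M * x ^ 2) ^ 3 := hgap.trans (by gcongr)
    _ = 125 / 36 * M * M ^ 2 * x ^ 6 := by ring
    _ ≤ 125 / 36 * (18 * m ^ 2 * γ) * M ^ 2 * x ^ 6 := by gcongr
    _ ≤ γ * (8 * m * M * x ^ 3) ^ 2 := by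
        have : 0 ≤ m ^ 2 * γ * M ^ 2 * x ^ 6 := by positivity
        linarith

include hg hγ hM hΛ hm hΛM in
theorem lazyIterate_le_sub_sum (zs : E) {k : ℕ} (hk : k ≤ m) :
    g (lazyIterate g M zs k) ≤ g zs - M / 6 *
      ∑ t ∈ Finset.range k, ‖lazyIterate g M zs (t + 1) - lazyIterate g M zs t‖ ^ 3 := by
  set z := lazyIterate g M zs
  set r : ℕ → ℝ := fun t => ‖z (t + 1) - z t‖
  set S : ℕ → ℝ := fun t => ‖z t - zs‖
  set R := ∑ t ∈ Finset.range k, r t ^ 3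
  have hpath : Λ * ∑ t ∈ Finset.range k, S t * r t ^ 2 ≤ Λ * (2 / 3 * ((k : ℝ) - 1) * R) :=
    mul_le_mul_of_nonneg_left (sum_mul_sq_le_of_le_sum (fun t => norm_nonneg _)
      (norm_lazyIterate_sub_le g M zs) k) hΛ
  have hsteps : g (z k) - g zs ≤
      -(M / 2 - Λ) * R + Λ * ∑ t ∈ Finset.range k, S t * r t ^ 2 := by
    calc g (z k) - g zs = ∑ t ∈ Finset.range k, (g (z (t + 1)) - g (z t)) :=
          (Finset.sum_range_sub (fun t => g (z t)) k).symm
      _ ≤ ∑ t ∈ Finset.range k, (-(M / 2 - Λ) * r t ^ 3 + Λ * (S t * r t ^ 2)) := by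
          refine Finset.sum_le_sum fun t _ => ?_
          have hstep := hg.le_sub_of_mem_crnOracle hγ.le (hg.crnStep_mem_crnOracle hM zs (z t))
          rw [← lazyIterate] at hstep
          linarith
      _ = _ := by rw [Finset.sum_add_distrib, ← Finset.mul_sum, ← Finset.mul_sum]
  have hbudget : Λ * (1 + 2 / 3 * ((k : ℝ) - 1)) * R ≤ M / 3 * R := by
    have hm1 : (1 : ℝ) ≤ m := by exact_mod_cast hm
    have hkm : (k : ℝ) ≤ m := by exact_mod_cast hk
    gcongr
    nlinarith
  linarith

include hg hγ hM hΛ hm hΛM hMγ hw in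
theorem sum_sub_min_lazyIterate_le (zs : E) {k : ℕ} (hk : k ≤ m) :
    ∑ t ∈ Finset.range k, (g (lazyIterate g M zs (t + 1)) - g w) ≤
      384 * m * ((g zs - g w) - (g (lazyIterate g M zs k) - g w)) := by
  set z := lazyIterate g M zs
  set R := ∑ t ∈ Finset.range k, ‖z (t + 1) - z t‖ ^ 3
  calc ∑ t ∈ Finset.range k, (g (z (t + 1)) - g w)
      ≤ ∑ t ∈ Finset.range k, 8 * m * M * (‖z (t + 1) - z t‖ + ‖z t - zs‖ / m) ^ 3 :=
        Finset.sum_le_sum fun t _ => hg.sub_min_lazyIterate_succ_le hγ hM hΛ hm hΛM hMγ hw zs t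
    _ = 8 * m * M * ∑ t ∈ Finset.range k, (‖z (t + 1) - z t‖ + ‖z t - zs‖ / m) ^ 3 :=
        (Finset.mul_sum _ _ _).symm
    _ ≤ 8 * m * M * (8 * R) := by
        gcongr
        exact sum_add_div_pow_three_le (fun t => norm_nonneg _) (fun t => norm_nonneg _)
          (norm_lazyIterate_sub_le g M zs) hm hk
    _ = 384 * m * (M / 6 * R) := by ring
    _ ≤ _ := by
        gcongr
        linarith [hg.lazyIterate_le_sub_sum hγ hM hΛ hm hΛM zs hk]

include hg hγ hM hΛ hm hΛM hMγ hw

theorem sub_min_lazyEpoch_le (zs : E) :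
    g (lazyEpoch g M m zs) - g w ≤ (1 - 1 / 769) * (g zs - g w) := by
  have hm0 : (0 : ℝ) < m := by exact_mod_cast hm
  have hsum := sum_le_mul_of_sum_le_mul_sub (δ := fun t => g (lazyIterate g M zs t) - g w)
    (C := 384) (by norm_num) hm (sub_nonneg.2 (hw _))
    (fun k hk => hg.sum_sub_min_lazyIterate_le hγ hM hΛ hm hΛM hMγ hw zs hk)
  rw [Finset.sum_sub_distrib, Finset.sum_const, Finset.card_range, nsmul_eq_mul,
    lazyIterate.eq_1] at hsum
  have havg := hg.le_average hγ.le (Nat.one_le_iff_ne_zero.1 hm) fun t => lazyIterate g M zs (t + 1)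
  rw [← lazyEpoch_eq_sum_range] at havg
  refine le_of_mul_le_mul_left ?_ hm0
  norm_num at hsum ⊢
  linarith

theorem sub_min_iterate_lazyEpoch_le (zs : E) (n : ℕ) :
    g ((lazyEpoch g M m)^[n] zs) - g w ≤ (1 - 1 / 769) ^ n * (g zs - g w) := by
  induction n with
  | zero => simp
  | succ n ih =>
    rw [Function.iterate_succ_apply', pow_succ']
    calc _ ≤ (1 - 1 / 769) * (g ((lazyEpoch g M m)^[n] zs) - g w) :=
          hg.sub_min_lazyEpoch_le hγ hM hΛ hm hΛM hMγ hw _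
      _ ≤ (1 - 1 / 769) * ((1 - 1 / 769) ^ n * (g zs - g w)) :=
          mul_le_mul_of_nonneg_left ih (by norm_num)
      _ = _ := by ring

end CubicallyConvex

end LazyEpoch

section MSSolver

variable {E : Type*} [NormedAddCommGroup E] [InnerProductSpace ℝ E] [CompleteSpace E]
  {f g : E → ℝ} {L γ M : ℝ} {m K : ℕ} {w : E}

/-- The choice of parameters for which `msSolver` is analysed; `γ` and `M` are as in the paper. -/
structure MSParams (L γ M : ℝ) (m K : ℕ) : Prop where
  L_pos : 0 < L
  one_le_m : 1 ≤ m
  γ_eq : γ = L / m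
  M_eq : M = 6 * m * (L + 2 * γ)
  le_K : 40000 * (m * (1 + Real.log m)) ≤ (K : ℝ)

/-- The Monteiro–Svaiter condition: `y` is a proximal point of `f` at `zbar` with regularization
parameter `lam`, up to a relative error of `1 / 2`. -/
def MonteiroSvaiter (f : E → ℝ) (lam : ℝ) (zbar y : E) : Prop :=
  ‖gradient f y + lam • (y - zbar)‖ ≤ 1 / 2 * (lam * ‖y - zbar‖)

namespace MSParams

variable (hp : MSParams L γ M m K)
include hp

theorem cast_m_pos : (0 : ℝ) < m := by exact_mod_cast hp.one_le_m

theorem γ_pos : 0 < γ := by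
  rw [hp.γ_eq]
  exact div_pos hp.L_pos hp.cast_m_pos

theorem L_eq : L = m * γ := by
  rw [hp.γ_eq, mul_div_cancel₀ _ hp.cast_m_pos.ne']

theorem γ_le_L : γ ≤ L := by
  rw [hp.γ_eq]
  exact div_le_self hp.L_pos.le (by exact_mod_cast hp.one_le_m)

theorem one_sub_pow_le : (1 - 1 / 769 : ℝ) ^ ⌈(K : ℝ) / m⌉₊ ≤ 1 / (10 ^ 12 * (m : ℝ) ^ 4) := by
  have hlog : 0 ≤ Real.log m := Real.log_natCast_nonneg m
  have hm := hp.cast_m_pos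
  have hexp : (10 : ℝ) ^ 12 ≤ Real.exp 40 := by
    calc (10 : ℝ) ^ 12 ≤ 2 ^ 40 := by norm_num
      _ ≤ Real.exp 1 ^ 40 := by
          gcongr
          linarith [Real.add_one_le_exp 1]
      _ = Real.exp 40 := by
          rw [← Real.exp_nat_mul]
          norm_num
  calc _ ≤ Real.exp (-40) * (m : ℝ) ^ (-4 : ℝ) := by
        refine one_sub_pow_ceil_div_le (by norm_num) (by norm_num) hm ?_
        nlinarith [hp.le_K, mul_nonneg hm.le hlog]
    _ = 1 / (Real.exp 40 * (m : ℝ) ^ 4) := by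
        rw [Real.exp_neg, Real.rpow_neg hm.le, Real.rpow_ofNat, one_div, mul_inv]
    _ ≤ _ := by gcongr

theorem norm_iterate_lazyEpoch_sub_le (hg : CubicallyConvex γ (L + 4 * γ) g)
    (hw : ∀ z, g w ≤ g z) {z : E} {D : ℝ} (hD : 0 ≤ D) (hz : g z - g w ≤ 5000 * L * D ^ 3) :
    ‖(lazyEpoch g M m)^[⌈(K : ℝ) / m⌉₊] z - w‖ ≤ D / (100 * m) := by
  have hm := hp.cast_m_pos
  have hm1 : (1 : ℝ) ≤ m := by exact_mod_cast hp.one_le_m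
  have hγ := hp.γ_pos
  have hL := hp.L_pos
  set z' := (lazyEpoch g M m)^[⌈(K : ℝ) / m⌉₊] z
  have hM0 : 0 < M := by
    rw [hp.M_eq]
    positivity
  have hΛM : 3 * m * (L + 4 * γ) ≤ M := by
    rw [hp.M_eq]
    nlinarith
  have hMγ : M ≤ 18 * m ^ 2 * γ := by
    rw [hp.M_eq, hp.L_eq]
    nlinarith [mul_pos hm hγ]
  have hgap : g z' - g w ≤ 1 / (10 ^ 12 * (m : ℝ) ^ 4) * (5000 * L * D ^ 3) :=
    (hg.sub_min_iterate_lazyEpoch_le hγ hM0 (by positivity) hp.one_le_m hΛM hMγ hw z _).trans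
      (mul_le_mul hp.one_sub_pow_le hz (sub_nonneg.2 (hw _)) (by positivity))
  refine le_of_pow_le_pow_left₀ three_ne_zero (by positivity)
    (le_of_mul_le_mul_left ?_ (show 0 < γ / 12 by positivity))
  have hscale : 0 ≤ γ * D ^ 3 / m ^ 3 := by positivity
  calc γ / 12 * ‖z' - w‖ ^ 3 ≤ 1 / (10 ^ 12 * (m : ℝ) ^ 4) * (5000 * L * D ^ 3) :=
        (hg.mul_norm_sub_pow_three_le_sub hw z').trans hgap
    _ = 5000 / 10 ^ 12 * (γ * D ^ 3 / m ^ 3) := by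
        rw [hp.L_eq]
        field_simp
    _ ≤ 1 / (12 * 100 ^ 3) * (γ * D ^ 3 / m ^ 3) := mul_le_mul_of_nonneg_right (by norm_num) hscale
    _ = γ / 12 * (D / (100 * m)) ^ 3 := by field_simp

theorem norm_gradient_proxFun_msSolver_le (hf : HasLipschitzHessian L f)
    (hc : ConvexOn ℝ Set.univ f) (zbar : E) :
    ‖gradient (proxFun f γ zbar) (msSolver f L K M m γ zbar)‖ ≤
      1 / 2 * (γ * ‖msSolver f L K M m γ zbar - zbar‖ ^ 2) := by
  have hm := hp.cast_m_pos
  have hm1 : (1 : ℝ) ≤ m := by exact_mod_cast hp.one_le_m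
  have hγ := hp.γ_pos
  have hL := hp.L_pos
  have hΛ : L + 4 * γ ≤ 5 * L := by linarith [hp.γ_le_L]
  have hg := cubicallyConvex_proxFun hγ.le hf hc zbar
  obtain ⟨w, hw⟩ := hg.exists_forall_le hγ
  rw [msSolver]
  set g := proxFun f γ zbar
  set zfirst := crnStep L (gradient g) zbar (hess g zbar)
  set zlast := (lazyEpoch g M m)^[⌈(K : ℝ) / m⌉₊] zfirst
  set y := crnStep L (gradient g) zlast (hess g zlast)
  set D := ‖zbar - w‖ with hD
  have hy : y ∈ crnOracle L (gradient g) zlast (hess g zlast) := hg.crnStep_mem_crnOracle hL _ _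
  have hfirst : g zfirst - g w ≤ 5000 * L * D ^ 3 :=
    hg.sub_min_le_norm_sub_minimizer_pow_three hL hΛ hw (hg.crnStep_mem_crnOracle hL _ _) hγ.le
  have hlast : ‖zlast - w‖ ≤ D / (100 * m) :=
    hp.norm_iterate_lazyEpoch_sub_le hg hw (norm_nonneg _) hfirst
  have hfar : D / 2 ≤ ‖y - zbar‖ := by
    have htri := norm_sub_le (y - w) (y - zbar)
    rw [sub_sub_sub_cancel_left, ← hD] at htri
    have : 0 ≤ D := norm_nonneg _
    have : D / (100 * m) ≤ D / 100 := by
      gcongr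
      linarith
    linarith [hg.norm_sub_minimizer_le_of_mem_crnOracle hL hΛ hw hy]
  calc ‖gradient g y‖ ≤ 550 * L * ‖zlast - w‖ ^ 2 :=
        hg.norm_gradient_le_norm_sub_minimizer_sq hL hΛ hw hy
    _ ≤ 550 * L * (D / (100 * m)) ^ 2 := by gcongr
    _ = 11 / 200 * (γ * D ^ 2) / m := by
        rw [hp.L_eq]
        field_simp
        ring
    _ ≤ 11 / 200 * (γ * D ^ 2) := div_le_self (by positivity) hm1
    _ ≤ 1 / 2 * (γ * (D / 2) ^ 2) := by
        have : 0 ≤ γ * D ^ 2 := by positivity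
        linarith
    _ ≤ _ := by gcongr

theorem monteiroSvaiter_msSolver (hf : HasLipschitzHessian L f) (hc : ConvexOn ℝ Set.univ f)
    (zbar : E) :
    MonteiroSvaiter f (γ * ‖msSolver f L K M m γ zbar - zbar‖) zbar
      (msSolver f L K M m γ zbar) := by
  have h := hp.norm_gradient_proxFun_msSolver_le hf hc zbar
  rw [gradient_proxFun (hf.1.differentiable two_ne_zero)] at h
  rw [MonteiroSvaiter, mul_assoc γ, ← pow_two, ← smul_smul]
  exact h

end MSParams

end MSSolver

section GuessDynamics

/-- One iteration of adaptive Monteiro–Svaiter acceleration, as seen by the weight `A`, the guess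
`ℓ` of the regularization parameter and the accumulated progress `X`: either the guess is halved
and the weight grows as in the optimal method, or the guess is doubled and progress is made. -/
def IsGuessUpdate (A ℓ X A' ℓ' X' : ℝ) : Prop :=
  (ℓ' = ℓ / 2 ∧ √A + 1 / (2 * √ℓ) ≤ √A' ∧ X ≤ X') ∨
    (ℓ' = 2 * ℓ ∧ A ≤ A' ∧ X + A * ℓ ^ 3 ≤ X')

/-- The deviation, in binary logarithmic scale, of the guess `ℓ` from the level `θ ^ 2 / b ^ 2`. -/
noncomputable def guessDeviation (θ b ℓ : ℝ) : ℝ :=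
  Real.logb 2 (ℓ * b ^ 2 / θ ^ 2)

variable {b b' c ℓ ℓ' θ X X' : ℝ}

theorem IsGuessUpdate.scale {A A' G : ℝ} (h : IsGuessUpdate A ℓ X A' ℓ' X') (hG : 0 < G) :
    IsGuessUpdate (A * G) (ℓ / G) (X / G ^ 2) (A' * G) (ℓ' / G) (X' / G ^ 2) := by
  rcases h with ⟨rfl, hA, hX⟩ | ⟨rfl, hA, hX⟩
  · refine Or.inl ⟨by ring, ?_, by gcongr⟩
    rw [Real.sqrt_mul' _ hG.le, Real.sqrt_mul' _ hG.le, Real.sqrt_div' _ hG.le]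
    calc √A * √G + 1 / (2 * (√ℓ / √G)) = (√A + 1 / (2 * √ℓ)) * √G := by
          field_simp
      _ ≤ √A' * √G := by gcongr
  · refine Or.inr ⟨by ring, by gcongr, ?_⟩
    calc X / G ^ 2 + A * G * (ℓ / G) ^ 3 = (X + A * ℓ ^ 3) / G ^ 2 := by field_simp
      _ ≤ X' / G ^ 2 := by gcongr

theorem IsGuessUpdate.le {A A' : ℝ} (h : IsGuessUpdate A ℓ X A' ℓ' X') (hA : 0 < A) :
    A ≤ A' := by
  rcases h with ⟨-, hA', -⟩ | ⟨-, hA', -⟩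
  · have : 0 ≤ 1 / (2 * √ℓ) := by positivity
    exact (Real.sqrt_le_sqrt_iff' hA).1 (by linarith)
  · exact hA'

theorem IsGuessUpdate.guess_pos {A A' : ℝ} (h : IsGuessUpdate A ℓ X A' ℓ' X') (hℓ : 0 < ℓ) :
    0 < ℓ' := by
  rcases h with ⟨rfl, -⟩ | ⟨rfl, -⟩ <;> positivity

theorem IsGuessUpdate.progress_le {A A' : ℝ} (h : IsGuessUpdate A ℓ X A' ℓ' X') (hA : 0 ≤ A)
    (hℓ : 0 ≤ ℓ) : X ≤ X' := by
  rcases h with ⟨-, -, hX⟩ | ⟨-, -, hX⟩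
  · exact hX
  · exact (le_add_of_nonneg_right (by positivity)).trans hX

theorem sq_add_le_sq_or_four_mul_pow_three_le (hb : 0 ≤ b) (hc : 0 ≤ c)
    (h : b ^ 3 + 3 * c * b ≤ b' ^ 3) : b ^ 2 + c ≤ b' ^ 2 ∨ 4 * b ^ 3 ≤ b' ^ 3 := by
  rcases le_total c (b ^ 2) with hcb | hcb
  · left
    refine le_of_pow_le_pow_left₀ three_ne_zero (by positivity) ?_
    calc (b ^ 2 + c) ^ 3 ≤ (b ^ 3 + 3 * c * b) ^ 2 := by
          have : c ^ 2 * c ≤ c ^ 2 * b ^ 2 := by gcongr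
          have : 0 ≤ c * b ^ 4 := by positivity
          have : 0 ≤ c ^ 2 * b ^ 2 := by positivity
          linarith
      _ ≤ (b' ^ 3) ^ 2 := by gcongr
      _ = (b' ^ 2) ^ 3 := by ring
  · right
    have : b ^ 2 * b ≤ c * b := by gcongr
    linarith

theorem guessDeviation_eq (hθ : 0 < θ) (hb : 0 < b) (hℓ : 0 < ℓ) :
    guessDeviation θ b ℓ = Real.logb 2 ℓ + 2 * Real.logb 2 b - 2 * Real.logb 2 θ := by
  rw [guessDeviation, Real.logb_div (by positivity) (by positivity),
    Real.logb_mul (by positivity) (by positivity), Real.logb_pow, Real.logb_pow]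
  norm_cast

theorem two_le_of_pow_three_add_le (hb : 0 < b) (hbb : b ≤ b') (hℓ : 0 < ℓ) (hθ : 0 < θ)
    (hlow : ℓ * b ^ 2 ≤ 2 * θ ^ 2) (h : b ^ 3 + 1 / (2 * √ℓ) ≤ b' ^ 3) :
    2 ≤ 18 * (θ * (b' ^ 2 - b ^ 2)) + 3 * (Real.logb 2 b' - Real.logb 2 b) := by
  have hlog : Real.logb 2 b ≤ Real.logb 2 b' := Real.logb_le_logb_of_le (by norm_num) hb hbb
  have hsq : b ^ 2 ≤ b' ^ 2 := by gcongr
  have hgain : 3 * (1 / (9 * θ)) * b ≤ 1 / (2 * √ℓ) := by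
    have hs : 2 * √ℓ * b ≤ 3 * θ := by
      refine le_of_sq_le_sq ?_ (by positivity)
      rw [mul_pow, mul_pow, Real.sq_sqrt hℓ.le]
      linarith [sq_nonneg θ]
    rw [le_div_iff₀ (by positivity)]
    field_simp
    linarith
  rcases sq_add_le_sq_or_four_mul_pow_three_le hb.le (b' := b') (c := 1 / (9 * θ)) (by positivity)
    (by linarith) with hlinear | hgeometric
  · have : θ * (1 / (9 * θ)) ≤ θ * (b' ^ 2 - b ^ 2) := by
      gcongr
      linarith
    have : θ * (1 / (9 * θ)) = 1 / 9 := by field_simp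
    linarith
  · have hlog4 := Real.logb_le_logb_of_le (b := 2) (by norm_num) (by positivity) hgeometric
    rw [Real.logb_mul (by norm_num) (by positivity), Real.logb_pow, Real.logb_pow,
      show (4 : ℝ) = 2 ^ (2 : ℝ) by norm_num, Real.logb_rpow (by norm_num) (by norm_num)] at hlog4
    have : 0 ≤ θ * (b' ^ 2 - b ^ 2) := mul_nonneg hθ.le (sub_nonneg.2 hsq)
    push_cast at hlog4
    linarith

theorem one_add_abs_guessDeviation_half_le (hb : 0 < b) (hbb : b ≤ b') (hℓ : 0 < ℓ) (hθ : 0 < θ)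
    (h : b ^ 3 + 1 / (2 * √ℓ) ≤ b' ^ 3) :
    1 + |guessDeviation θ b' (ℓ / 2)| ≤ |guessDeviation θ b ℓ| +
      18 * (θ * (b' ^ 2 - b ^ 2)) + 5 * (Real.logb 2 b' - Real.logb 2 b) := by
  have hlog : Real.logb 2 b ≤ Real.logb 2 b' := Real.logb_le_logb_of_le (by norm_num) hb hbb
  have hshift : guessDeviation θ b' (ℓ / 2) =
      guessDeviation θ b ℓ - 1 + 2 * (Real.logb 2 b' - Real.logb 2 b) := by
    rw [guessDeviation_eq hθ hb hℓ, guessDeviation_eq hθ (hb.trans_le hbb) (by positivity),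
      Real.logb_div hℓ.ne' (by norm_num), Real.logb_self_eq_one (by norm_num)]
    ring
  have hneg := neg_abs_le (guessDeviation θ b ℓ)
  have hself := le_abs_self (guessDeviation θ b ℓ)
  rcases le_total (guessDeviation θ b ℓ) 1 with hlow | hhigh
  · have hlow' : ℓ * b ^ 2 ≤ 2 * θ ^ 2 := by
      rwa [guessDeviation, Real.logb_le_iff_le_rpow (by norm_num) (by positivity), Real.rpow_one,
        div_le_iff₀ (by positivity)] at hlow
    have := two_le_of_pow_three_add_le hb hbb hℓ hθ hlow' h
    have : |guessDeviation θ b' (ℓ / 2)| ≤ |guessDeviation θ b ℓ| + 1 +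
        2 * (Real.logb 2 b' - Real.logb 2 b) := by
      rw [hshift]
      exact abs_le.2 ⟨by linarith, by linarith⟩
    linarith
  · have : |guessDeviation θ b' (ℓ / 2)| ≤ |guessDeviation θ b ℓ| - 1 +
        2 * (Real.logb 2 b' - Real.logb 2 b) := by
      rw [hshift]
      exact abs_le.2 ⟨by linarith, by linarith⟩
    have : 0 ≤ θ * (b' ^ 2 - b ^ 2) := mul_nonneg hθ.le (sub_nonneg.2 (by gcongr))
    linarith

theorem one_add_abs_guessDeviation_double_le (hb : 0 < b) (hbb : b ≤ b') (hℓ : 0 < ℓ) (hθ : 0 < θ)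
    (h : X + b ^ 6 * ℓ ^ 3 ≤ X') :
    1 + |guessDeviation θ b' (2 * ℓ)| ≤ |guessDeviation θ b ℓ| +
      2 * (Real.logb 2 b' - Real.logb 2 b) + 16 * ((X' - X) / θ ^ 6) := by
  have hlog : Real.logb 2 b ≤ Real.logb 2 b' := Real.logb_le_logb_of_le (by norm_num) hb hbb
  have hshift : guessDeviation θ b' (2 * ℓ) =
      guessDeviation θ b ℓ + 1 + 2 * (Real.logb 2 b' - Real.logb 2 b) := by
    rw [guessDeviation_eq hθ hb hℓ, guessDeviation_eq hθ (hb.trans_le hbb) (by positivity),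
      Real.logb_mul (by norm_num) hℓ.ne', Real.logb_self_eq_one (by norm_num)]
    ring
  have hneg := neg_abs_le (guessDeviation θ b ℓ)
  have hself := le_abs_self (guessDeviation θ b ℓ)
  have hX : (ℓ * b ^ 2 / θ ^ 2) ^ 3 ≤ (X' - X) / θ ^ 6 := by
    calc (ℓ * b ^ 2 / θ ^ 2) ^ 3 = b ^ 6 * ℓ ^ 3 / θ ^ 6 := by ring
      _ ≤ (X' - X) / θ ^ 6 := by
          gcongr
          linarith
  rcases le_total (-1) (guessDeviation θ b ℓ) with hhigh | hlow
  · rw [guessDeviation, Real.le_logb_iff_rpow_le (by norm_num) (by positivity)] at hhigh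
    rw [Real.rpow_neg_one] at hhigh
    have : (2⁻¹ : ℝ) ^ 3 ≤ (ℓ * b ^ 2 / θ ^ 2) ^ 3 := by gcongr
    have : |guessDeviation θ b' (2 * ℓ)| ≤ |guessDeviation θ b ℓ| + 1 +
        2 * (Real.logb 2 b' - Real.logb 2 b) := by
      rw [hshift]
      exact abs_le.2 ⟨by linarith, by linarith⟩
    linarith
  · have : |guessDeviation θ b' (2 * ℓ)| ≤ |guessDeviation θ b ℓ| - 1 +
        2 * (Real.logb 2 b' - Real.logb 2 b) := by
      rw [hshift]
      rw [abs_of_nonpos (show guessDeviation θ b ℓ ≤ 0 by linarith)] at hneg ⊢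
      exact abs_le.2 ⟨by linarith, by linarith⟩
    have : 0 ≤ (ℓ * b ^ 2 / θ ^ 2) ^ 3 := by positivity
    linarith

theorem IsGuessUpdate.one_add_abs_guessDeviation_le (h : IsGuessUpdate (b ^ 6) ℓ X (b' ^ 6) ℓ' X')
    (hb : 0 < b) (hb' : 0 < b') (hℓ : 0 < ℓ) (hθ : 0 < θ) :
    1 + |guessDeviation θ b' ℓ'| ≤ |guessDeviation θ b ℓ| + 18 * (θ * (b' ^ 2 - b ^ 2)) +
      5 * (Real.logb 2 b' - Real.logb 2 b) + 16 * ((X' - X) / θ ^ 6) := by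
  have hbb : b ≤ b' := le_of_pow_le_pow_left₀ (n := 6) (by norm_num) hb'.le (h.le (by positivity))
  have hsqrt : ∀ x : ℝ, 0 < x → √(x ^ 6) = x ^ 3 := fun x hx => by
    rw [show x ^ 6 = (x ^ 3) ^ 2 by ring, Real.sqrt_sq (by positivity)]
  rcases h with ⟨rfl, hA, hX⟩ | ⟨rfl, -, hX⟩
  · rw [hsqrt b hb, hsqrt b' hb'] at hA
    have : 0 ≤ (X' - X) / θ ^ 6 := div_nonneg (sub_nonneg.2 hX) (by positivity)
    linarith [one_add_abs_guessDeviation_half_le hb hbb hℓ hθ hA]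
  · have : 0 ≤ θ * (b' ^ 2 - b ^ 2) := mul_nonneg hθ.le (sub_nonneg.2 (by gcongr))
    have := Real.logb_le_logb_of_le (b := 2) (by norm_num) hb hbb
    linarith [one_add_abs_guessDeviation_double_le hb hbb hℓ hθ hX]

end GuessDynamics

section IterationCount

variable {b A ℓ X : ℕ → ℝ} {θ G : ℝ}

theorem add_abs_guessDeviation_le (hb : ∀ t, 0 < b t) (hℓ : ∀ t, 0 < ℓ t) (hθ : 0 < θ)
    (h : ∀ t, IsGuessUpdate (b t ^ 6) (ℓ t) (X t) (b (t + 1) ^ 6) (ℓ (t + 1)) (X (t + 1))) (n : ℕ) :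
    n + |guessDeviation θ (b n) (ℓ n)| ≤ |guessDeviation θ (b 0) (ℓ 0)| +
      18 * (θ * (b n ^ 2 - b 0 ^ 2)) + 5 * (Real.logb 2 (b n) - Real.logb 2 (b 0)) +
      16 * ((X n - X 0) / θ ^ 6) := by
  induction n with
  | zero => simp
  | succ n ih =>
    have := (h n).one_add_abs_guessDeviation_le (hb n) (hb (n + 1)) (hℓ n) hθ
    rw [sub_div] at this ih ⊢
    push_cast
    linarith

theorem abs_guessDeviation_rpow_le {b b' ℓ : ℝ} (hb : 1 ≤ b) (hbb : b ≤ b') (hℓ : 0 < ℓ)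
    (hℓb : ℓ * b ^ 6 = 1 / 2) :
    |guessDeviation (b' ^ (-(2 / 7) : ℝ)) b ℓ| ≤ 1 + 4 * Real.logb 2 b' := by
  have hb0 := one_pos.trans_le hb
  have hb0' := hb0.trans_le hbb
  have hlogb : 0 ≤ Real.logb 2 b := Real.logb_nonneg (by norm_num) hb
  have hlogb' : Real.logb 2 b ≤ Real.logb 2 b' := Real.logb_le_logb_of_le (by norm_num) hb0 hbb
  have hlogℓ := congrArg (Real.logb 2) hℓb
  rw [Real.logb_mul hℓ.ne' (pow_pos hb0 6).ne', Real.logb_pow, one_div, Real.logb_inv,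
    Real.logb_self_eq_one (by norm_num)] at hlogℓ
  push_cast at hlogℓ
  rw [guessDeviation_eq (Real.rpow_pos_of_pos hb0' _) hb0 hℓ,
    Real.logb_rpow_eq_mul_logb_of_pos hb0']
  exact abs_le.2 ⟨by linarith, by linarith⟩

theorem add_one_le_mul_rpow_of_isGuessUpdate_pow (hb : ∀ t, 0 < b t) (hℓ : ∀ t, 0 < ℓ t)
    (h : ∀ t, IsGuessUpdate (b t ^ 6) (ℓ t) (X t) (b (t + 1) ^ 6) (ℓ (t + 1)) (X (t + 1)))
    (hb0 : 1 ≤ b 0) (hℓ0 : ℓ 0 * b 0 ^ 6 = 1 / 2) {n : ℕ} (hX : X n ≤ X 0 + 1) :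
    (n : ℝ) + 1 ≤ 52 * b n ^ (12 / 7 : ℝ) := by
  have hbn : b 0 ≤ b n := monotone_nat_of_le_succ (fun t => le_of_pow_le_pow_left₀ (n := 6)
    (by norm_num) (hb _).le ((h t).le (pow_pos (hb t) 6))) n.zero_le
  have hbn1 := hb0.trans hbn
  set θ := b n ^ (-(2 / 7) : ℝ) with hθ
  have hθ0 : 0 < θ := Real.rpow_pos_of_pos (hb n) _
  set Y := b n ^ (12 / 7 : ℝ) with hY
  have hpotential := add_abs_guessDeviation_le hb hℓ hθ0 h n
  have hθb : θ * b n ^ 2 = Y := by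
    rw [hθ, hY, ← Real.rpow_natCast, ← Real.rpow_add (hb n)]
    norm_num
  have hθX : (X n - X 0) / θ ^ 6 ≤ Y := by
    have hYθ : Y = 1 / θ ^ 6 := by
      rw [hθ, hY, ← Real.rpow_natCast, ← Real.rpow_mul (hb n).le, one_div,
        ← Real.rpow_neg (hb n).le]
      norm_num
    rw [hYθ]
    gcongr
    linarith
  have hinit := abs_guessDeviation_rpow_le hb0 hbn (hℓ 0) hℓ0
  have hlog0 : 0 ≤ Real.logb 2 (b 0) := Real.logb_nonneg (by norm_num) hb0
  have hlogn : Real.logb 2 (b n) ≤ 2 * (Y - 1) := by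
    have hbY : b n ≤ Y := Real.self_le_rpow_of_one_le hbn1 (by norm_num)
    rw [Real.logb, div_le_iff₀ (Real.log_pos (by norm_num))]
    nlinarith [Real.log_le_sub_one_of_pos (hb n), Real.log_two_gt_d9]
  have : 0 ≤ θ * b 0 ^ 2 := by positivity
  linarith [abs_nonneg (guessDeviation θ (b n) (ℓ n))]

theorem add_one_le_mul_rpow_of_isGuessUpdate (hℓ : ∀ t, 0 < ℓ t)
    (h : ∀ t, IsGuessUpdate (A t) (ℓ t) (X t) (A (t + 1)) (ℓ (t + 1)) (X (t + 1)))
    (hℓ0 : ℓ 0 * A 0 = 1 / 2) (hG : 0 < G) (hA0 : 1 ≤ A 0 * G) {n : ℕ} (hX : X n ≤ X 0 + G ^ 2) :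
    (n : ℝ) + 1 ≤ 52 * (A n * G) ^ (2 / 7 : ℝ) := by
  have hA : ∀ t, 1 ≤ A t * G := fun t => by
    induction t with
    | zero => exact hA0
    | succ t ih =>
      have hpos : 0 < A t := pos_of_mul_pos_left (one_pos.trans_le ih) hG.le
      exact ih.trans (by gcongr; exact (h t).le hpos)
  set b : ℕ → ℝ := fun t => (A t * G) ^ (1 / 6 : ℝ)
  have hb : ∀ t, 0 < b t := fun t => Real.rpow_pos_of_pos (one_pos.trans_le (hA t)) _
  have hb6 : ∀ t, b t ^ 6 = A t * G := fun t => by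
    rw [← Real.rpow_mul_natCast (one_pos.trans_le (hA t)).le]
    norm_num
  have hcount := add_one_le_mul_rpow_of_isGuessUpdate_pow (b := b) (ℓ := fun t => ℓ t / G)
    (X := fun t => X t / G ^ 2) (n := n) hb (fun t => div_pos (hℓ t) hG)
    (fun t => by simpa only [hb6] using (h t).scale hG)
    (Real.one_le_rpow (hA 0) (by norm_num))
    (by rw [hb6, ← hℓ0]; field_simp)
    (by rw [div_le_iff₀ (by positivity)]; field_simp; linarith)
  rwa [← Real.rpow_mul (one_pos.trans_le (hA n)).le,
    show (1 / 6 * (12 / 7) : ℝ) = 2 / 7 by norm_num] at hcount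

end IterationCount

section Potential

variable {E : Type*} [NormedAddCommGroup E]
  {f : E → ℝ} {w y z z' v zbar : E} {A B a lam lam' s ρ : ℝ}

/-- The potential of accelerated proximal-point methods, for the reference point `w`. -/
noncomputable def msPotential (f : E → ℝ) (w : E) (A : ℝ) (z v : E) : ℝ :=
  A * (f z - f w) + ‖v - w‖ ^ 2 / 2

theorem msPotential_nonneg (hw : ∀ z, f w ≤ f z) (hA : 0 ≤ A) (z v : E) :
    0 ≤ msPotential f w A z v :=
  add_nonneg (mul_nonneg hA (sub_nonneg.2 (hw z))) (by positivity)

variable [InnerProductSpace ℝ E] [CompleteSpace E]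

theorem MonteiroSvaiter.norm_gradient_sq_add_le (h : MonteiroSvaiter f lam zbar y) :
    ‖gradient f y‖ ^ 2 + 3 / 4 * lam ^ 2 * ‖y - zbar‖ ^ 2 ≤
      2 * lam * ⟪gradient f y, zbar - y⟫_ℝ := by
  have hsq : ‖gradient f y + lam • (y - zbar)‖ ^ 2 ≤ (1 / 2 * (lam * ‖y - zbar‖)) ^ 2 :=
    pow_le_pow_left₀ (norm_nonneg _) h 2
  rw [norm_add_sq_real, norm_smul, real_inner_smul_right, mul_pow, Real.norm_eq_abs,
    sq_abs] at hsq
  rw [← neg_sub y zbar, inner_neg_right]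
  linarith

theorem MonteiroSvaiter.mul_norm_gradient_sq_add_le (h : MonteiroSvaiter f lam zbar y)
    (hlam : 0 ≤ lam) (hB : 0 ≤ B) (hs : s * lam ≤ B) :
    s * ‖gradient f y‖ ^ 2 + 3 / 4 * (B * lam * ‖y - zbar‖ ^ 2) ≤
      2 * (B * ⟪gradient f y, zbar - y⟫_ℝ) := by
  rcases hlam.eq_or_lt with rfl | hlam
  · have : gradient f y = 0 := by simpa [MonteiroSvaiter] using h
    simp [this]
  · refine le_of_mul_le_mul_left ?_ hlam
    calc lam * (s * ‖gradient f y‖ ^ 2 + 3 / 4 * (B * lam * ‖y - zbar‖ ^ 2))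
        = s * lam * ‖gradient f y‖ ^ 2 + B * (3 / 4 * lam ^ 2 * ‖y - zbar‖ ^ 2) := by ring
      _ ≤ B * ‖gradient f y‖ ^ 2 + B * (3 / 4 * lam ^ 2 * ‖y - zbar‖ ^ 2) := by gcongr
      _ = B * (‖gradient f y‖ ^ 2 + 3 / 4 * lam ^ 2 * ‖y - zbar‖ ^ 2) := by ring
      _ ≤ B * (2 * lam * ⟪gradient f y, zbar - y⟫_ℝ) := by
          gcongr
          exact h.norm_gradient_sq_add_le
      _ = lam * (2 * (B * ⟪gradient f y, zbar - y⟫_ℝ)) := by ring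

theorem linear_coupling_le (hc : ConvexOn ℝ Set.univ f) (hd : DifferentiableAt ℝ f y)
    (hA : 0 ≤ A) (ha : 0 ≤ a) (hzbar : (A + a) • zbar = A • z + a • v) :
    (A + a) * ⟪gradient f y, zbar - y⟫_ℝ + (A + a) * (f y - f w) - A * (f z - f w) ≤
      a * ⟪gradient f y, v - w⟫_ℝ := by
  have hvec : a • (v - w) = (A + a) • (zbar - y) - A • (z - y) - a • (w - y) := by
    rw [smul_sub (A + a), hzbar]
    module
  have hinner : a * ⟪gradient f y, v - w⟫_ℝ = (A + a) * ⟪gradient f y, zbar - y⟫_ℝ -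
      A * ⟪gradient f y, z - y⟫_ℝ - a * ⟪gradient f y, w - y⟫_ℝ := by
    rw [← real_inner_smul_right, hvec]
    simp only [inner_sub_right, real_inner_smul_right]
  have hz := mul_le_mul_of_nonneg_left (add_inner_gradient_le_of_convexOn hc hd z) hA
  have hw := mul_le_mul_of_nonneg_left (add_inner_gradient_le_of_convexOn hc hd w) ha
  linarith

theorem msPotential_add_le (hc : ConvexOn ℝ Set.univ f) (hd : DifferentiableAt ℝ f y)
    (hy : MonteiroSvaiter f lam zbar y) (hlam : 0 ≤ lam) (hA : 0 ≤ A) (ha : 0 ≤ a) (hρ : 0 ≤ ρ)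
    (haA : lam' * a ^ 2 = A + a) (hle : ρ * lam ≤ lam')
    (hzbar : (A + a) • zbar = A • z + a • v)
    (hz' : (A + ρ * a) * (f z' - f w) ≤
      (1 - ρ) * A * (f z - f w) + ρ * (A + a) * (f y - f w)) :
    msPotential f w (A + ρ * a) z' (v - (ρ * a) • gradient f y) +
      3 / 8 * ((A + a) * (ρ * lam) * ‖y - zbar‖ ^ 2) ≤ msPotential f w A z v := by
  have hv : ‖v - (ρ * a) • gradient f y - w‖ ^ 2 = ‖v - w‖ ^ 2 -
      2 * (ρ * (a * ⟪gradient f y, v - w⟫_ℝ)) + ρ * (ρ * a ^ 2 * ‖gradient f y‖ ^ 2) := by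
    rw [sub_right_comm, norm_sub_sq_real, real_inner_smul_right, norm_smul, mul_pow,
      Real.norm_eq_abs, sq_abs, real_inner_comm]
    ring
  have hcoupling := mul_le_mul_of_nonneg_left
    (linear_coupling_le (w := w) hc hd hA ha hzbar) hρ
  have hms := mul_le_mul_of_nonneg_left
    (hy.mul_norm_gradient_sq_add_le (s := ρ * a ^ 2) hlam (add_nonneg hA ha)
      (by rw [← haA, mul_right_comm]; gcongr)) hρ
  rw [msPotential, msPotential, hv]
  linarith

end Potential

section Weight

variable {A lam : ℝ}

/-- The weight `a'` of an iteration of A-LEN: the positive root `a` of `lam * a ^ 2 = A + a`. -/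
noncomputable def msWeight (A lam : ℝ) : ℝ :=
  1 / (2 * lam) * (1 + √(1 + 4 * lam * A))

theorem msWeight_pos (hlam : 0 < lam) : 0 < msWeight A lam := by
  unfold msWeight
  positivity

theorem mul_msWeight_sq (hA : 0 ≤ A) (hlam : 0 < lam) :
    lam * msWeight A lam ^ 2 = A + msWeight A lam := by
  have hs := Real.sq_sqrt (show 0 ≤ 1 + 4 * lam * A by positivity)
  rw [msWeight]
  generalize √(1 + 4 * lam * A) = r at hs
  field_simp
  linarith

theorem sqrt_add_one_div_le_sqrt_add_msWeight (hA : 0 ≤ A) (hlam : 0 < lam) :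
    √A + 1 / (2 * √lam) ≤ √(A + msWeight A lam) := by
  have hl := Real.sq_sqrt hlam.le
  have hroot : 2 * √lam * √A ≤ √(1 + 4 * lam * A) := by
    refine Real.le_sqrt_of_sq_le ?_
    rw [mul_pow, mul_pow, hl, Real.sq_sqrt hA]
    linarith
  rw [← mul_msWeight_sq hA hlam, Real.sqrt_mul hlam.le, Real.sqrt_sq (msWeight_pos hlam).le]
  calc √A + 1 / (2 * √lam) = (1 + 2 * √lam * √A) / (2 * √lam) := by
        field_simp
        ring
    _ ≤ (1 + √(1 + 4 * lam * A)) / (2 * √lam) := by gcongr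
    _ = √lam * msWeight A lam := by
        rw [msWeight]
        generalize √(1 + 4 * lam * A) = r
        field_simp
        rw [hl]

end Weight

theorem mul_map_div_smul_add_sub_le {V : Type*} [AddCommGroup V] [Module ℝ V] {f : V → ℝ}
    (hc : ConvexOn ℝ Set.univ f) {p q c r : ℝ} (hp : 0 ≤ p) (hq : 0 ≤ q) (hpq : p + q = c)
    (hc0 : 0 < c) (x y : V) :
    c * (f ((p / c) • x + (q / c) • y) - r) ≤ p * (f x - r) + q * (f y - r) := by
  have hconv := hc.2 (Set.mem_univ x) (Set.mem_univ y) (div_nonneg hp hc0.le)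
    (div_nonneg hq hc0.le) (by rw [← add_div, hpq, div_self hc0.ne'])
  simp only [smul_eq_mul] at hconv
  calc c * (f ((p / c) • x + (q / c) • y) - r) ≤ c * (p / c * f x + q / c * f y - r) := by gcongr
    _ = p * (f x - r) + q * (f y - r) := by
        rw [← hpq]
        have : p + q ≠ 0 := by rw [hpq]; exact hc0.ne'
        field_simp
        ring

section ALen

variable {E : Type*} [NormedAddCommGroup E] [InnerProductSpace ℝ E] [CompleteSpace E]
  {f : E → ℝ} {w y z v z₀ z₁ zbar : E} {A ℓ lam L M γ : ℝ} {K m t : ℕ}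

theorem MonteiroSvaiter.msPotential_one_div_add_le (h : MonteiroSvaiter f lam zbar y)
    (hc : ConvexOn ℝ Set.univ f) (hd : DifferentiableAt ℝ f y) (hlam : 0 < lam) :
    msPotential f w (1 / lam) y (zbar - (1 / lam) • gradient f y) + 3 / 8 * ‖y - zbar‖ ^ 2 ≤
      ‖zbar - w‖ ^ 2 / 2 := by
  have hstep := msPotential_add_le (w := w) (z := zbar) (v := zbar) (z' := y) (A := 0)
    (ρ := 1) (lam' := lam) (a := 1 / lam) hc hd h hlam.le le_rfl
    (by positivity) zero_le_one (by field_simp; simp) (one_mul _).le (by simp) (by simp)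
  simp only [zero_add, one_mul, one_div_mul_cancel hlam.ne'] at hstep
  simpa [msPotential] using hstep

theorem MonteiroSvaiter.norm_sub_le (h : MonteiroSvaiter f lam zbar y)
    (hc : ConvexOn ℝ Set.univ f) (hd : DifferentiableAt ℝ f y) (hw : ∀ z, f w ≤ f z)
    (hlam : 0 < lam) : ‖y - zbar‖ ≤ 2 * ‖zbar - w‖ := by
  have hstep := h.msPotential_one_div_add_le (w := w) hc hd hlam
  have hnonneg := msPotential_nonneg hw (one_div_pos.2 hlam).le y
    (zbar - (1 / lam) • gradient f y)
  refine le_of_sq_le_sq ?_ (by positivity)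
  linarith [sq_nonneg ‖zbar - w‖]

/-- The decrease of the potential, normalized so that an iteration of A-LEN that doubles the
guess `ℓ` contributes at least `A * ℓ ^ 3`. -/
noncomputable def msProgress (f : E → ℝ) (γ : ℝ) (w : E) (A : ℝ) (z v : E) : ℝ :=
  -(8 / 3 * γ ^ 2 * msPotential f w A z v)

theorem MonteiroSvaiter.isGuessUpdate_half (h : MonteiroSvaiter f lam zbar y)
    (hc : ConvexOn ℝ Set.univ f) (hd : DifferentiableAt ℝ f y) (hlam : 0 ≤ lam) (hle : lam ≤ ℓ)
    (hA : 0 ≤ A) (hℓ : 0 < ℓ)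
    (hzbar : (A + msWeight A ℓ) • zbar = A • z + msWeight A ℓ • v) :
    IsGuessUpdate A ℓ (msProgress f γ w A z v) (A + msWeight A ℓ) (1 / 2 * ℓ)
      (msProgress f γ w (A + msWeight A ℓ) y (v - msWeight A ℓ • gradient f y)) := by
  have ha := msWeight_pos (A := A) hℓ
  have hstep := msPotential_add_le (w := w) (z' := y) (ρ := 1) hc hd h hlam hA ha.le zero_le_one
    (mul_msWeight_sq hA hℓ) ((one_mul _).trans_le hle) hzbar (by simp)
  have : 0 ≤ 3 / 8 * ((A + msWeight A ℓ) * (1 * lam) * ‖y - zbar‖ ^ 2) := by positivity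
  refine Or.inl ⟨by ring, sqrt_add_one_div_le_sqrt_add_msWeight hA hℓ, neg_le_neg ?_⟩
  simp only [one_mul] at hstep this
  gcongr
  linarith

theorem MonteiroSvaiter.isGuessUpdate_double {ρ a : ℝ}
    (h : MonteiroSvaiter f (γ * ‖y - zbar‖) zbar y) (hc : ConvexOn ℝ Set.univ f)
    (hd : DifferentiableAt ℝ f y) (hA : 0 ≤ A) (hℓ : 0 < ℓ) (hlt : ℓ < γ * ‖y - zbar‖)
    (hρ : ρ = ℓ / (γ * ‖y - zbar‖)) (ha : a = msWeight A ℓ)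
    (hzbar : (A + a) • zbar = A • z + a • v) :
    IsGuessUpdate A ℓ (msProgress f γ w A z v) (A + ρ * a) (2 * ℓ)
      (msProgress f γ w (A + ρ * a)
        (((1 - ρ) * A / (A + ρ * a)) • z + (ρ * (A + a) / (A + ρ * a)) • y)
        (v - (ρ * a) • gradient f y)) := by
  have hlam := hℓ.trans hlt
  have ha0 : 0 < a := ha ▸ msWeight_pos hℓ
  have hρ0 : 0 < ρ := hρ ▸ div_pos hℓ hlam
  have hρ1 : ρ < 1 := hρ ▸ (div_lt_one hlam).2 hlt
  have hρℓ : ρ * (γ * ‖y - zbar‖) = ℓ := by rw [hρ, div_mul_cancel₀ _ hlam.ne']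
  have hstep := msPotential_add_le (w := w) hc hd h hlam.le hA ha0.le hρ0.le
    (ha ▸ mul_msWeight_sq hA hℓ) hρℓ.le hzbar (mul_map_div_smul_add_sub_le hc
      (mul_nonneg (sub_nonneg.2 hρ1.le) hA) (by positivity) (by ring) (by positivity) z y)
  refine Or.inr ⟨rfl, le_add_of_nonneg_right (by positivity), ?_⟩
  have hdecrease : 3 / 8 * (A * ℓ ^ 3) ≤
      γ ^ 2 * (3 / 8 * ((A + a) * (ρ * (γ * ‖y - zbar‖)) * ‖y - zbar‖ ^ 2)) := by
    calc 3 / 8 * (A * ℓ ^ 3) = 3 / 8 * (A * ℓ * ℓ ^ 2) := by ring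
      _ ≤ 3 / 8 * ((A + a) * ℓ * (γ * ‖y - zbar‖) ^ 2) := by
          gcongr
          linarith
      _ = γ ^ 2 * (3 / 8 * ((A + a) * (ρ * (γ * ‖y - zbar‖)) * ‖y - zbar‖ ^ 2)) := by
          rw [hρℓ]
          ring
  have hscaled := mul_le_mul_of_nonneg_left hstep (sq_nonneg γ)
  unfold msProgress
  linarith

theorem alenIter_one (hγ : 0 < γ) (hne : z₁ ≠ z₀) :
    alenIter f L 2 K M m γ z₀ z₁ 1 =
      ⟨z₁, z₀ - (1 / (γ * ‖z₁ - z₀‖)) • gradient f z₁, 1 / (γ * ‖z₁ - z₀‖),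
        γ * ‖z₁ - z₀‖ / 2, msSolverSteps K m⟩ := by
  have hlam : γ * ‖z₁ - z₀‖ ≠ 0 := (mul_pos hγ (norm_sub_pos_iff.2 hne)).ne'
  simp only [alenIter, if_true, le_refl]
  generalize γ * ‖z₁ - z₀‖ = lam at hlam
  have ha : 1 / (2 * lam) * (1 + √(1 + 4 * lam * 0)) = 1 / lam := by
    rw [mul_zero, add_zero, Real.sqrt_one]
    field_simp
    norm_num
  rw [ha, zero_add, one_div_mul_eq_div]

theorem isGuessUpdate_alenIter (hc : ConvexOn ℝ Set.univ f) (hd : Differentiable ℝ f) (hγ : 0 ≤ γ)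
    (hMS : ∀ zbar, MonteiroSvaiter f (γ * ‖msSolver f L K M m γ zbar - zbar‖) zbar
      (msSolver f L K M m γ zbar))
    {st st' : ALenState E} (hst : alenIter f L 2 K M m γ z₀ z₁ t = st)
    (hst' : alenIter f L 2 K M m γ z₀ z₁ (t + 1) = st')
    (ht : t ≠ 0) (hA : 0 ≤ st.A) (hlam : 0 < st.lam) :
    IsGuessUpdate st.A st.lam (msProgress f γ w st.A st.z st.v)
      st'.A st'.lam (msProgress f γ w st'.A st'.z st'.v) := by
  rw [alenIter, hst] at hst'
  have hweight : 1 / (2 * st.lam) * (1 + √(1 + 4 * st.lam * st.A)) = msWeight st.A st.lam := rfl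
  simp only [ht, if_false, hweight] at hst'
  set a := msWeight st.A st.lam with ha
  set zbar := (st.A / (st.A + a)) • st.z + (a / (st.A + a)) • st.v with hzbar
  have hzbar' : (st.A + a) • zbar = st.A • st.z + a • st.v := by
    have hne : st.A + a ≠ 0 := (add_pos_of_nonneg_of_pos hA (msWeight_pos hlam)).ne'
    rw [hzbar, smul_add, smul_smul, smul_smul, mul_div_cancel₀ _ hne, mul_div_cancel₀ _ hne]
  split_ifs at hst' with hle <;> subst hst'
  · exact (hMS zbar).isGuessUpdate_half hc (hd _) (by positivity) hle hA hlam hzbar'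
  · exact (hMS zbar).isGuessUpdate_double hc (hd _) hA hlam (not_le.1 hle) rfl ha hzbar'

section Iterates

variable (hc : ConvexOn ℝ Set.univ f) (hd : Differentiable ℝ f) (hγ : 0 < γ)
  (hMS : ∀ zbar, MonteiroSvaiter f (γ * ‖msSolver f L K M m γ zbar - zbar‖) zbar
    (msSolver f L K M m γ zbar))
  (hne : z₁ ≠ z₀)

include hc hd hγ hMS hne

theorem alenIter_succ_pos (t : ℕ) : 0 < (alenIter f L 2 K M m γ z₀ z₁ (t + 1)).A ∧
    0 < (alenIter f L 2 K M m γ z₀ z₁ (t + 1)).lam := by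
  induction t with
  | zero =>
    have hlam : 0 < γ * ‖z₁ - z₀‖ := mul_pos hγ (norm_sub_pos_iff.2 hne)
    rw [alenIter_one hγ hne]
    exact ⟨one_div_pos.2 hlam, half_pos hlam⟩
  | succ t ih =>
    have hupdate := isGuessUpdate_alenIter (w := z₀) hc hd hγ.le hMS rfl rfl
      t.succ_ne_zero ih.1.le ih.2
    exact ⟨ih.1.trans_le (hupdate.le ih.1), hupdate.guess_pos ih.2⟩

theorem msPotential_alenIter_succ_le (hz₁ : MonteiroSvaiter f (γ * ‖z₁ - z₀‖) z₀ z₁) (t : ℕ)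
    {st : ALenState E} (hst : alenIter f L 2 K M m γ z₀ z₁ (t + 1) = st) :
    msPotential f w st.A st.z st.v ≤ ‖z₀ - w‖ ^ 2 / 2 := by
  induction t generalizing st with
  | zero =>
    have := hz₁.msPotential_one_div_add_le (w := w) hc (hd z₁)
      (mul_pos hγ (norm_sub_pos_iff.2 hne))
    rw [zero_add, alenIter_one hγ hne] at hst
    subst hst
    linarith [sq_nonneg ‖z₁ - z₀‖]
  | succ t ih =>
    obtain ⟨hA, hlam⟩ := alenIter_succ_pos hc hd hγ hMS hne t
    have hupdate := isGuessUpdate_alenIter (w := w) hc hd hγ.le hMS rfl hst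
      t.succ_ne_zero hA.le hlam
    refine le_trans (le_of_mul_le_mul_left ?_ (show 0 < 8 / 3 * γ ^ 2 by positivity)) (ih rfl)
    exact neg_le_neg_iff.1 (hupdate.progress_le hA.le hlam.le)

theorem natCast_le_mul_rpow_alenIter (hz₁ : MonteiroSvaiter f (γ * ‖z₁ - z₀‖) z₀ z₁)
    (hw : ∀ z, f w ≤ f z) {T : ℕ} (hT : 1 ≤ T) :
    (T : ℝ) ≤ 52 * ((alenIter f L 2 K M m γ z₀ z₁ T).A * (2 * γ * ‖z₀ - w‖)) ^ (2 / 7 : ℝ) := by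
  obtain ⟨n, rfl⟩ := Nat.exists_eq_add_of_le' hT
  have hr : 0 < ‖z₁ - z₀‖ := norm_sub_pos_iff.2 hne
  have hrD : ‖z₁ - z₀‖ ≤ 2 * ‖z₀ - w‖ := hz₁.norm_sub_le hc (hd z₁) hw (mul_pos hγ hr)
  have hD : 0 < ‖z₀ - w‖ := by linarith
  have hpos := alenIter_succ_pos hc hd hγ hMS hne
  set st : ℕ → ALenState E := fun t => alenIter f L 2 K M m γ z₀ z₁ (t + 1)
  have hst0 : st 0 = ⟨z₁, _, _, _, _⟩ := alenIter_one hγ hne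
  have hcount := add_one_le_mul_rpow_of_isGuessUpdate (A := fun t => (st t).A)
    (ℓ := fun t => (st t).lam) (G := 2 * γ * ‖z₀ - w‖) (n := n)
    (X := fun t => msProgress f γ w (st t).A (st t).z (st t).v) (fun t => (hpos t).2)
    (fun t => isGuessUpdate_alenIter hc hd hγ.le hMS rfl rfl t.succ_ne_zero (hpos t).1.le
      (hpos t).2)
    (by simp only [hst0]; field_simp) (by positivity)
    (by
      simp only [hst0]
      rw [one_div_mul_eq_div, one_le_div (mul_pos hγ hr)]
      nlinarith)
    (by
      have hn := msPotential_nonneg hw (hpos n).1.le (st n).z (st n).v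
      have h0 := msPotential_alenIter_succ_le (w := w) hc hd hγ hMS hne hz₁ 0 (st := st 0) rfl
      unfold msProgress
      nlinarith [mul_nonneg (sq_nonneg γ) hn, mul_le_mul_of_nonneg_left h0 (sq_nonneg γ),
        sq_nonneg (γ * ‖z₀ - w‖)])
  exact_mod_cast hcount

end Iterates

theorem rpow_mul_sub_min_alen_le (hc : ConvexOn ℝ Set.univ f) (hd : Differentiable ℝ f)
    (hw : ∀ z, f w ≤ f z) (hγ : 0 < γ)
    (hMS : ∀ zbar, MonteiroSvaiter f (γ * ‖msSolver f L K M m γ zbar - zbar‖) zbar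
      (msSolver f L K M m γ zbar))
    {T : ℕ} (hT : 1 ≤ T) (z₀ : E) :
    (T / 52 : ℝ) ^ (7 / 2 : ℝ) * (f (alen f L z₀ T 2 K M m γ).1 - f w) ≤
      γ * ‖z₀ - w‖ ^ 3 := by
  have hMS₀ := hMS z₀
  rw [alen]
  by_cases hne : msSolver f L K M m γ z₀ = z₀
  · have hgrad : gradient f z₀ = 0 := by simpa [MonteiroSvaiter, hne] using hMS₀
    have hle := add_inner_gradient_le_of_convexOn hc (hd z₀) w
    rw [hgrad, inner_zero_left, add_zero] at hle
    simp only [hne, if_true]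
    rw [(hw z₀).antisymm hle, sub_self, mul_zero]
    positivity
  simp only [hne, if_false]
  obtain ⟨n, rfl⟩ := Nat.exists_eq_add_of_le' hT
  have hcount := natCast_le_mul_rpow_alenIter hc hd hγ hMS hne hMS₀ hw hT
  have hpotential := msPotential_alenIter_succ_le (w := w) hc hd hγ hMS hne hMS₀ n rfl
  have hA := (alenIter_succ_pos hc hd hγ hMS hne n).1
  set st := alenIter f L 2 K M m γ z₀ (msSolver f L K M m γ z₀) (n + 1)
  have hgrowth : ((n + 1 : ℕ) / 52 : ℝ) ^ (7 / 2 : ℝ) ≤ st.A * (2 * γ * ‖z₀ - w‖) := by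
    calc ((n + 1 : ℕ) / 52 : ℝ) ^ (7 / 2 : ℝ)
        ≤ ((st.A * (2 * γ * ‖z₀ - w‖)) ^ (2 / 7 : ℝ)) ^ (7 / 2 : ℝ) := by
          gcongr
          linarith
      _ = st.A * (2 * γ * ‖z₀ - w‖) := by
          rw [← Real.rpow_mul (by positivity)]
          norm_num
  have hgap : st.A * (f st.z - f w) ≤ ‖z₀ - w‖ ^ 2 / 2 :=
    (le_add_of_nonneg_right (by positivity)).trans hpotential
  calc ((n + 1 : ℕ) / 52 : ℝ) ^ (7 / 2 : ℝ) * (f st.z - f w)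
      ≤ st.A * (2 * γ * ‖z₀ - w‖) * (f st.z - f w) := by
        gcongr
        exact sub_nonneg.2 (hw _)
    _ = 2 * γ * ‖z₀ - w‖ * (st.A * (f st.z - f w)) := by ring
    _ ≤ 2 * γ * ‖z₀ - w‖ * (‖z₀ - w‖ ^ 2 / 2) := by gcongr
    _ = γ * ‖z₀ - w‖ ^ 3 := by ring

end ALen

section Epochs

theorem half_rpow_three_halves_pow_succ_sq (s : ℕ) :
    ((1 / 2 : ℝ) ^ ((3 / 2 : ℝ) ^ (s + 1))) ^ 2 = ((1 / 2 : ℝ) ^ ((3 / 2 : ℝ) ^ s)) ^ 3 := by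
  rw [← Real.rpow_mul_natCast (by norm_num), ← Real.rpow_mul_natCast (by norm_num), pow_succ]
  congr 1
  push_cast
  ring

theorem le_half_rpow_mul_of_mul_sq_le_pow_three {c R : ℝ} {d : ℕ → ℝ} (hd : ∀ s, 0 ≤ d s)
    (hc : 0 ≤ c) (hR : 0 < R) (hcR : c ≤ R) (h0 : d 0 ^ 3 ≤ R * c ^ 2)
    (h : ∀ s, 8 * R * d (s + 1) ^ 2 ≤ d s ^ 3) (s : ℕ) :
    d (s + 1) ≤ (1 / 2 : ℝ) ^ ((3 / 2 : ℝ) ^ (s + 1)) * c := by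
  refine le_of_sq_le_sq (le_of_mul_le_mul_left ?_ (show 0 < 8 * R by positivity)) (by positivity)
  rw [mul_pow, half_rpow_three_halves_pow_succ_sq]
  refine (h s).trans ?_
  induction s with
  | zero =>
    norm_num
    linarith
  | succ s ih =>
    set e := (1 / 2 : ℝ) ^ ((3 / 2 : ℝ) ^ (s + 1))
    have hprev : d (s + 1) ≤ e * c := by
      refine le_of_sq_le_sq (le_of_mul_le_mul_left ?_ (show 0 < 8 * R by positivity))
        (by positivity)
      rw [mul_pow, half_rpow_three_halves_pow_succ_sq]
      exact (h s).trans ih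
    calc d (s + 1) ^ 3 ≤ (e * c) ^ 3 := pow_le_pow_left₀ (hd _) hprev 3
      _ = e ^ 3 * c ^ 2 * c := by ring
      _ ≤ e ^ 3 * c ^ 2 * (8 * R) := by
          gcongr
          linarith
      _ = 8 * R * (e ^ 3 * c ^ 2) := by ring

variable {ε : ℝ}

theorem one_lt_logb_two_one_div (hε : 0 < ε) (hε2 : ε < 1 / 2) : 1 < Real.logb 2 (1 / ε) := by
  rw [Real.lt_logb_iff_rpow_lt (by norm_num) (by positivity), Real.rpow_one, lt_div_iff₀ hε]
  linarith

theorem one_le_numEpochs (hε : 0 < ε) (hε2 : ε < 1 / 2) : 1 ≤ numEpochs ε := by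
  rw [numEpochs, Nat.one_le_ceil_iff]
  exact Real.logb_pos (by norm_num) (one_lt_logb_two_one_div hε hε2)

theorem half_rpow_numEpochs_le (hε : 0 < ε) (hε2 : ε < 1 / 2) :
    (1 / 2 : ℝ) ^ ((3 / 2 : ℝ) ^ numEpochs ε) ≤ ε := by
  have hlog := one_lt_logb_two_one_div hε hε2
  have hexp : Real.logb 2 (1 / ε) ≤ (3 / 2 : ℝ) ^ numEpochs ε := by
    rw [← Real.rpow_natCast, ← Real.logb_le_iff_le_rpow (by norm_num) (by linarith)]
    exact Nat.le_ceil _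
  calc (1 / 2 : ℝ) ^ ((3 / 2 : ℝ) ^ numEpochs ε) ≤ (1 / 2 : ℝ) ^ Real.logb 2 (1 / ε) :=
        Real.rpow_le_rpow_of_exponent_ge (by norm_num) (by norm_num) hexp
    _ = ε := by
        rw [one_div, Real.inv_rpow (by norm_num), Real.rpow_logb (by norm_num) (by norm_num)
          (by positivity), one_div, inv_inv]

theorem four_thirds_le_log_one_div (hε : 0 < ε) (hε4 : ε ≤ 1 / 4) :
    4 / 3 ≤ Real.log (1 / ε) := by
  calc (4 / 3 : ℝ) ≤ 2 * Real.log 2 := by linarith [Real.log_two_gt_d9]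
    _ = Real.log (2 ^ 2) := by rw [Real.log_pow, Nat.cast_ofNat]
    _ ≤ Real.log (1 / ε) := by
        refine Real.log_le_log (by norm_num) ((le_div_iff₀ hε).2 ?_)
        linarith

theorem one_div_four_le_log_log_one_div (hε : 0 < ε) (hε4 : ε ≤ 1 / 4) :
    1 / 4 ≤ Real.log (Real.log (1 / ε)) := by
  calc (1 / 4 : ℝ) = 1 - (4 / 3)⁻¹ := by norm_num
    _ ≤ Real.log (4 / 3) := Real.one_sub_inv_le_log_of_pos (by norm_num)
    _ ≤ Real.log (Real.log (1 / ε)) :=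
        Real.log_le_log (by norm_num) (four_thirds_le_log_one_div hε hε4)

theorem logb_logb_two_le {x : ℝ} (hx : 1 ≤ Real.log x) :
    Real.logb (3 / 2) (Real.logb 2 x) ≤ 3 * (Real.log (Real.log x) + 3 / 4) := by
  have hlog32 : 1 / 3 ≤ Real.log (3 / 2) :=
    le_trans (by norm_num) (Real.one_sub_inv_le_log_of_pos (show (0 : ℝ) < 3 / 2 by norm_num))
  have hloglog2 : -Real.log (Real.log 2) ≤ 3 / 4 := by
    have : Real.log (1 / 2) ≤ Real.log (Real.log 2) :=
      Real.log_le_log (by norm_num) (by linarith [Real.log_two_gt_d9])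
    rw [one_div, Real.log_inv] at this
    linarith [Real.log_two_lt_d9]
  have hnonneg := Real.log_nonneg hx
  rw [Real.logb, Real.logb, Real.log_div (by linarith) (Real.log_pos one_lt_two).ne',
    div_le_iff₀ (by linarith)]
  calc Real.log (Real.log x) - Real.log (Real.log 2)
      ≤ 3 * (Real.log (Real.log x) + 3 / 4) * (1 / 3) := by linarith
    _ ≤ 3 * (Real.log (Real.log x) + 3 / 4) * Real.log (3 / 2) := by gcongr

theorem numEpochs_le (hε : 0 < ε) (hε4 : ε ≤ 1 / 4) :
    (numEpochs ε : ℝ) ≤ 16 * Real.log (Real.log (1 / ε)) := by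
  have hloglog := one_div_four_le_log_log_one_div hε hε4
  have hlog := four_thirds_le_log_one_div hε hε4
  have hceil : (numEpochs ε : ℝ) < Real.logb (3 / 2) (Real.logb 2 (1 / ε)) + 1 :=
    Nat.ceil_lt_add_one
      (Real.logb_pos (by norm_num) (one_lt_logb_two_one_div hε (by linarith))).le
  linarith [logb_logb_two_le (by linarith : 1 ≤ Real.log (1 / ε))]

end Epochs

section Restart

variable {E : Type*} [NormedAddCommGroup E] [InnerProductSpace ℝ E] [CompleteSpace E]
  {f : E → ℝ} {w : E} {μ L M γ : ℝ} {K m T : ℕ}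

/-- The radius `R` of the region in which an epoch of A-LEN with `T` iterations converges
superlinearly: the distance `r` to the minimizer becomes at most `r * √(r / (8 * R))`. -/
noncomputable def alenRadius (μ γ : ℝ) (T : ℕ) : ℝ :=
  μ / γ * (T / 208) ^ (7 / 2 : ℝ)

theorem alenRadius_pos (hμ : 0 < μ) (hγ : 0 < γ) (hT : 1 ≤ T) : 0 < alenRadius μ γ T := by
  have : (0 : ℝ) < T := by exact_mod_cast hT
  unfold alenRadius
  positivity

theorem le_alenRadius {Y : ℝ} (hμ : 0 < μ) (hγ : 0 < γ) (hY : 0 ≤ Y)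
    (h : 208 * (γ * Y / μ) ^ (2 / 7 : ℝ) ≤ T) : Y ≤ alenRadius μ γ T := by
  calc Y = μ / γ * ((γ * Y / μ) ^ (2 / 7 : ℝ)) ^ (7 / 2 : ℝ) := by
        rw [← Real.rpow_mul (by positivity)]
        norm_num
        field_simp
    _ ≤ alenRadius μ γ T := by
        unfold alenRadius
        gcongr
        linarith

theorem natCast_div_rpow_seven_halves (T : ℕ) :
    (T / 52 : ℝ) ^ (7 / 2 : ℝ) = 128 * (T / 208) ^ (7 / 2 : ℝ) := by
  have h4 : (4 : ℝ) ^ (7 / 2 : ℝ) = 128 := by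
    rw [show (4 : ℝ) = 2 ^ (2 : ℝ) by norm_num, ← Real.rpow_mul (by norm_num)]
    norm_num
  rw [← h4, ← Real.mul_rpow (by norm_num) (by positivity)]
  congr 1
  ring

section Convergence

variable (hp : MSParams L γ M m K) (hμ : 0 < μ) (hsc : StrongConvexOn Set.univ μ f)
  (hf : HasLipschitzHessian L f) (hw : ∀ z, f w ≤ f z) (hT : 1 ≤ T)

include hp hμ hsc hf hw hT

theorem mul_norm_alen_sub_sq_le (z₀ : E) :
    8 * alenRadius μ γ T * ‖(alen f L z₀ T 2 K M m γ).1 - w‖ ^ 2 ≤ ‖z₀ - w‖ ^ 3 := by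
  have hγ := hp.γ_pos
  have hc : ConvexOn ℝ Set.univ f := (hsc.strictConvexOn hμ).convexOn
  set y := (alen f L z₀ T 2 K M m γ).1
  have hvalue : (T / 52 : ℝ) ^ (7 / 2 : ℝ) * (f y - f w) ≤ γ * ‖z₀ - w‖ ^ 3 :=
    rpow_mul_sub_min_alen_le hc (hf.1.differentiable two_ne_zero) hw hγ
      (hp.monteiroSvaiter_msSolver hf hc) hT z₀
  have hgrowth : μ / 2 * ‖y - w‖ ^ 2 ≤ f y - f w :=
    half_mul_norm_sq_le_sub_of_strongConvexOn hsc hw y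
  refine le_of_mul_le_mul_left ?_ hγ
  calc γ * (8 * alenRadius μ γ T * ‖y - w‖ ^ 2)
      = 8 * (T / 208 : ℝ) ^ (7 / 2 : ℝ) * (2 * (μ / 2 * ‖y - w‖ ^ 2)) := by
        rw [alenRadius]
        field_simp
    _ ≤ 8 * (T / 208 : ℝ) ^ (7 / 2 : ℝ) * (8 * (f y - f w)) := by
        gcongr
        linarith [sub_nonneg.2 (hw y)]
    _ ≤ (T / 52 : ℝ) ^ (7 / 2 : ℝ) * (f y - f w) := by
        rw [natCast_div_rpow_seven_halves]
        have := mul_nonneg (show 0 ≤ (T / 208 : ℝ) ^ (7 / 2 : ℝ) by positivity)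
          (sub_nonneg.2 (hw y))
        linarith
    _ ≤ γ * ‖z₀ - w‖ ^ 3 := hvalue

theorem norm_alenRestart_sub_le {z₀ : E} {c : ℝ} (hc : 0 ≤ c) (hcR : c ≤ alenRadius μ γ T)
    (h0 : ‖z₀ - w‖ ^ 3 ≤ alenRadius μ γ T * c ^ 2) {s : ℕ} (hs : 1 ≤ s) :
    ‖(alenRestart f L z₀ T 2 K M m γ s).1 - w‖ ≤ (1 / 2 : ℝ) ^ ((3 / 2 : ℝ) ^ s) * c := by
  obtain ⟨s, rfl⟩ := Nat.exists_eq_add_of_le' hs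
  exact le_half_rpow_mul_of_mul_sq_le_pow_three
    (d := fun s => ‖(alenRestart f L z₀ T 2 K M m γ s).1 - w‖) (fun _ => norm_nonneg _) hc
    (alenRadius_pos hμ hp.γ_pos hT) hcR h0
    (fun _ => mul_norm_alen_sub_sq_le hp hμ hsc hf hw hT _) s

theorem norm_alenRestart_sub_le_of_le_alenRadius {z₀ : E} (h0 : ‖z₀ - w‖ ≤ alenRadius μ γ T)
    {s : ℕ} (hs : 1 ≤ s) :
    ‖(alenRestart f L z₀ T 2 K M m γ s).1 - w‖ ≤
      (1 / 2 : ℝ) ^ ((3 / 2 : ℝ) ^ s) * ‖z₀ - w‖ :=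
  norm_alenRestart_sub_le hp hμ hsc hf hw hT (norm_nonneg _) h0
    (by rw [pow_succ']; gcongr) hs

theorem norm_alenRestart_sub_sq_le {z₀ : E} (h0 : ‖z₀ - w‖ ≤ alenRadius μ γ T)
    {s : ℕ} (hs : 1 ≤ s) :
    ‖(alenRestart f L z₀ T 2 K M m γ s).1 - w‖ ^ 2 ≤
      (1 / 2 : ℝ) ^ ((3 / 2 : ℝ) ^ s) * ‖z₀ - w‖ ^ 2 := by
  have hle := norm_alenRestart_sub_le_of_le_alenRadius hp hμ hsc hf hw hT h0 hs
  have hone : (1 / 2 : ℝ) ^ ((3 / 2 : ℝ) ^ s) ≤ 1 :=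
    Real.rpow_le_one (by norm_num) (by norm_num) (by positivity)
  calc ‖(alenRestart f L z₀ T 2 K M m γ s).1 - w‖ ^ 2
      ≤ ((1 / 2 : ℝ) ^ ((3 / 2 : ℝ) ^ s) * ‖z₀ - w‖) ^ 2 := by gcongr
    _ = ((1 / 2 : ℝ) ^ ((3 / 2 : ℝ) ^ s)) ^ 2 * ‖z₀ - w‖ ^ 2 := mul_pow _ _ _
    _ ≤ (1 / 2 : ℝ) ^ ((3 / 2 : ℝ) ^ s) * ‖z₀ - w‖ ^ 2 := by
        gcongr
        exact pow_le_of_le_one (by positivity) hone two_ne_zero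

theorem norm_alenRestart_numEpochs_sub_le_mul {z₀ : E} (h0 : ‖z₀ - w‖ ≤ alenRadius μ γ T)
    {ε : ℝ} (hε : 0 < ε) (hε2 : ε < 1 / 2) :
    ‖(alenRestart f L z₀ T 2 K M m γ (numEpochs ε)).1 - w‖ ≤ ε * ‖z₀ - w‖ :=
  (norm_alenRestart_sub_le_of_le_alenRadius hp hμ hsc hf hw hT h0
    (one_le_numEpochs hε hε2)).trans (by gcongr; exact half_rpow_numEpochs_le hε hε2)

theorem norm_alenRestart_numEpochs_sub_le {z₀ : E} (h0 : ‖z₀ - w‖ ≤ alenRadius μ γ T)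
    (h0' : ‖z₀ - w‖ ^ 3 ≤ alenRadius μ γ T) {ε : ℝ} (hε : 0 < ε) (hε2 : ε < 1 / 2) :
    ‖(alenRestart f L z₀ T 2 K M m γ (numEpochs ε)).1 - w‖ ≤ ε := by
  rcases le_total ‖z₀ - w‖ 1 with hnear | hfar
  · exact (norm_alenRestart_numEpochs_sub_le_mul hp hμ hsc hf hw hT h0 hε hε2).trans
      (mul_le_of_le_one_right hε.le hnear)
  · have hle := norm_alenRestart_sub_le hp hμ hsc hf hw hT zero_le_one
      ((one_le_pow₀ hfar).trans h0') (by rwa [one_pow, mul_one]) (one_le_numEpochs hε hε2)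
    rw [mul_one] at hle
    exact hle.trans (half_rpow_numEpochs_le hε hε2)

end Convergence

end Restart

section Complexity

section StepCount

variable {E : Type*} [NormedAddCommGroup E] [InnerProductSpace ℝ E] [CompleteSpace E]
  {f : E → ℝ} {L α M γ : ℝ} {K m T : ℕ}

theorem alenIter_succ_steps (z₀ z1 : E) (t : ℕ) :
    (alenIter f L α K M m γ z₀ z1 (t + 1)).steps = (t + 1) * msSolverSteps K m := by
  induction t with
  | zero => simp [alenIter]
  | succ t ih =>
    rw [alenIter]
    simp only [Nat.succ_ne_zero, if_false, ih]
    split_ifs <;> exact (Nat.succ_mul _ _).symm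

theorem alen_steps_le (hT : 1 ≤ T) (z₀ : E) :
    (alen f L z₀ T α K M m γ).2 ≤ T * msSolverSteps K m := by
  rw [alen]
  split_ifs
  · exact Nat.le_mul_of_pos_left _ hT
  · obtain ⟨t, rfl⟩ := Nat.exists_eq_add_of_le' hT
    exact (alenIter_succ_steps z₀ _ t).le

theorem alenRestart_steps_le (hT : 1 ≤ T) (z₀ : E) (s : ℕ) :
    (alenRestart f L z₀ T α K M m γ s).2 ≤ s * (T * msSolverSteps K m) := by
  induction s with
  | zero => exact Nat.zero_le _
  | succ s ih =>
    rw [Nat.succ_mul]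
    exact Nat.add_le_add ih (alen_steps_le hT _)

theorem msSolverSteps_le (hm : 1 ≤ m) (hK : m ≤ K) : (msSolverSteps K m : ℝ) ≤ 4 * K := by
  have hm1 : (1 : ℝ) ≤ m := by exact_mod_cast hm
  have hmK : (m : ℝ) ≤ K := by exact_mod_cast hK
  have hceil : (⌈(K : ℝ) / m⌉₊ : ℝ) * m ≤ K + m :=
    calc (⌈(K : ℝ) / m⌉₊ : ℝ) * m ≤ (K / m + 1) * m := by
          gcongr
          exact (Nat.ceil_lt_add_one (by positivity)).le
      _ = K + m := by field_simp
  rw [msSolverSteps]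
  push_cast
  linarith

theorem numEpochs_mul_le {ε W : ℝ} (hε : 0 < ε) (hε4 : ε ≤ 1 / 4) (hW : 0 ≤ W) :
    numEpochs ε * W ≤ 16 * (W * Real.log (Real.log (1 / ε))) := by
  calc numEpochs ε * W ≤ 16 * Real.log (Real.log (1 / ε)) * W := by
        gcongr
        exact numEpochs_le hε hε4
    _ = 16 * (W * Real.log (Real.log (1 / ε))) := by ring

theorem total_work_le (hm : 1 ≤ m) (hK : m ≤ K) (hT : 1 ≤ T) (z₀ : E) {ε : ℝ} (hε : 0 < ε)
    (hε4 : ε ≤ 1 / 4) {c W : ℝ} (hW : m + T * K ≤ c * W) :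
    numEpochs ε * (m + T * K) ≤ 64 * c * (W * Real.log (Real.log (1 / ε))) ∧
    ((alenRestart f L z₀ T α K M m γ (numEpochs ε)).2 : ℝ) ≤
      64 * c * (W * Real.log (Real.log (1 / ε))) := by
  have hwork : 4 * (numEpochs ε * (m + T * K : ℝ)) ≤
      64 * c * (W * Real.log (Real.log (1 / ε))) := by
    have hcW : 0 ≤ c * W := le_trans (by positivity) hW
    calc 4 * (numEpochs ε * (m + T * K : ℝ)) ≤ 4 * (numEpochs ε * (c * W)) := by gcongr
      _ ≤ 4 * (16 * (c * W * Real.log (Real.log (1 / ε)))) :=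
          mul_le_mul_of_nonneg_left (numEpochs_mul_le hε hε4 hcW) (by norm_num)
      _ = 64 * c * (W * Real.log (Real.log (1 / ε))) := by ring
  refine ⟨le_trans ?_ hwork, le_trans ?_ hwork⟩
  · linarith [show 0 ≤ numEpochs ε * (m + T * K : ℝ) by positivity]
  · calc ((alenRestart f L z₀ T α K M m γ (numEpochs ε)).2 : ℝ)
        ≤ numEpochs ε * (T * msSolverSteps K m) := by
          exact_mod_cast alenRestart_steps_le hT z₀ (numEpochs ε)
      _ ≤ numEpochs ε * (T * (4 * K)) := by
          gcongr
          exact msSolverSteps_le hm hK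
      _ = 4 * (numEpochs ε * (0 + T * K)) := by ring
      _ ≤ 4 * (numEpochs ε * (m + T * K)) := by
          gcongr
          positivity

end StepCount

section EpochWork

variable {μ L γ M CK CT : ℝ} {m K T : ℕ}

theorem mul_le_abs_mul_abs_mul {k t w x : ℝ} (hk : 0 ≤ k) (hw : 0 ≤ w) (hx : 0 ≤ x)
    (hkw : k ≤ CK * w) (htx : t ≤ CT * x) : t * k ≤ |CK| * |CT| * (w * x) := by
  calc t * k ≤ (|CT| * x) * (|CK| * w) := by
        gcongr
        · exact htx.trans (by gcongr; exact le_abs_self _)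
        · exact hkw.trans (by gcongr; exact le_abs_self _)
    _ = |CK| * |CT| * (w * x) := by ring

namespace MSParams

variable (hp : MSParams L γ M m K)
include hp

theorem log_m_nonneg : 0 ≤ Real.log m :=
  Real.log_nonneg (by exact_mod_cast hp.one_le_m)

theorem m_le_K : m ≤ K := by
  have hle : (m : ℝ) ≤ m * (1 + Real.log m) :=
    le_mul_of_one_le_right hp.cast_m_pos.le (by linarith [hp.log_m_nonneg])
  have : (m : ℝ) ≤ K := by linarith [hp.le_K, hp.cast_m_pos]
  exact_mod_cast this

theorem m_mul_rpow_eq (hμ : 0 < μ) :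
    (m : ℝ) * (γ / μ) ^ (2 / 7 : ℝ) = (m : ℝ) ^ (5 / 7 : ℝ) * (L / μ) ^ (2 / 7 : ℝ) := by
  have hm := hp.cast_m_pos
  have hL := hp.L_pos
  rw [hp.γ_eq, div_right_comm, Real.div_rpow (by positivity) hm.le,
    show (5 / 7 : ℝ) = 1 - 2 / 7 by norm_num, Real.rpow_sub hm, Real.rpow_one]
  ring

variable (hμ : 0 < μ) (hK : K ≤ CK * (m * (1 + Real.log m)))
include hμ hK

theorem epoch_work_le (hT : T ≤ CT * (γ / μ) ^ (2 / 7 : ℝ)) :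
    m + T * K ≤ (1 + |CK| * |CT|) *
      (m + (m : ℝ) ^ (5 / 7 : ℝ) * (1 + Real.log m) * (L / μ) ^ (2 / 7 : ℝ)) := by
  have hγ := hp.γ_pos
  have hL := hp.L_pos
  set Y := (m : ℝ) ^ (5 / 7 : ℝ) * (1 + Real.log m) * (L / μ) ^ (2 / 7 : ℝ) with hY
  have hprod : (m : ℝ) * (1 + Real.log m) * (γ / μ) ^ (2 / 7 : ℝ) = Y := by
    rw [mul_right_comm, hp.m_mul_rpow_eq hμ, hY]
    ring
  have hTK : T * K ≤ |CK| * |CT| * Y := by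
    rw [← hprod]
    exact mul_le_abs_mul_abs_mul (by positivity) (by positivity) (by positivity) hK hT
  have hm : 0 ≤ |CK| * |CT| * m := by positivity
  have hY0 : 0 ≤ Y := by positivity
  linarith

theorem epoch_work_le_of_le_one_add (hT : T ≤ CT * (1 + (γ / μ) ^ (2 / 7 : ℝ))) :
    m + T * K ≤ (1 + |CK| * |CT|) *
      ((m + (m : ℝ) ^ (5 / 7 : ℝ) * (L / μ) ^ (2 / 7 : ℝ)) * (1 + Real.log m)) := by
  have hlog := hp.log_m_nonneg
  have hγ := hp.γ_pos
  rw [← hp.m_mul_rpow_eq hμ]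
  set x := (γ / μ) ^ (2 / 7 : ℝ)
  have hTK : T * K ≤ |CK| * |CT| * (m * (1 + Real.log m) * (1 + x)) :=
    mul_le_abs_mul_abs_mul (by positivity) (by positivity) (by positivity) hK hT
  have hm : (m : ℝ) ≤ (m + m * x) * (1 + Real.log m) :=
    (le_add_of_nonneg_right (by positivity)).trans
      (le_mul_of_one_le_right (by positivity) (by linarith))
  linarith

end MSParams

end EpochWork

end Complexity

end LazyNewton

open LazyNewton in
theorem theorem6_general.{u} :
    ∃ cK cT : ℝ, 0 < cK ∧ 0 < cT ∧ ∀ CK CT : ℝ, ∃ C : ℝ, 0 < C ∧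
      ∀ (E : Type u) [NormedAddCommGroup E] [InnerProductSpace ℝ E] [CompleteSpace E]
        (f : E → ℝ) (μ L : ℝ) (m : ℕ) (z₀ zstar : E) (γ M : ℝ) (K T : ℕ),
        0 < μ → 0 < L → 1 ≤ m →
        StrongConvexOn Set.univ μ f →
        HasLipschitzHessian L f →
        IsMinOn f Set.univ zstar →
        γ = L / m →
        M = 6 * m * (L + 2 * γ) →
        cK * (m * (1 + Real.log m)) ≤ K →
        1 ≤ T →
        cT * (γ * ‖z₀ - zstar‖ / μ) ^ (2 / 7 : ℝ) ≤ T →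
        (∀ s : ℕ, 1 ≤ s →
          ‖(alenRestart f L z₀ T 2 K M m γ s).1 - zstar‖ ^ 2 ≤
            (1 / 2 : ℝ) ^ ((3 / 2 : ℝ) ^ s) * ‖z₀ - zstar‖ ^ 2) ∧
        (∀ ε : ℝ, 0 < ε → ε < 1 / 2 →
          ‖(alenRestart f L z₀ T 2 K M m γ (numEpochs ε)).1 - zstar‖ ≤
            ε * ‖z₀ - zstar‖) ∧
        (cT * (γ * ‖z₀ - zstar‖ ^ 3 / μ) ^ (2 / 7 : ℝ) ≤ T →
          ∀ ε : ℝ, 0 < ε → ε < 1 / 2 →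
          ‖(alenRestart f L z₀ T 2 K M m γ (numEpochs ε)).1 - zstar‖ ≤ ε) ∧
        ((K : ℝ) ≤ CK * (m * (1 + Real.log m)) →
          (T : ℝ) ≤ CT * (γ / μ) ^ (2 / 7 : ℝ) →
          ∀ ε : ℝ, 0 < ε → ε ≤ 1 / 4 →
          (numEpochs ε : ℝ) * (m + T * K) ≤
            C * ((m + (m : ℝ) ^ (5 / 7 : ℝ) * (1 + Real.log m) * (L / μ) ^ (2 / 7 : ℝ)) *
              Real.log (Real.log (1 / ε))) ∧
          ((alenRestart f L z₀ T 2 K M m γ (numEpochs ε)).2 : ℝ) ≤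
            C * ((m + (m : ℝ) ^ (5 / 7 : ℝ) * (1 + Real.log m) * (L / μ) ^ (2 / 7 : ℝ)) *
              Real.log (Real.log (1 / ε)))) ∧
        ((K : ℝ) ≤ CK * (m * (1 + Real.log m)) →
          (T : ℝ) ≤ CT * (1 + (γ / μ) ^ (2 / 7 : ℝ)) →
          ∀ ε : ℝ, 0 < ε → ε ≤ 1 / 4 →
          (numEpochs ε : ℝ) * (m + T * K) ≤
            C * ((m + (m : ℝ) ^ (5 / 7 : ℝ) * (L / μ) ^ (2 / 7 : ℝ)) * (1 + Real.log m) *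
              Real.log (Real.log (1 / ε))) ∧
          ((alenRestart f L z₀ T 2 K M m γ (numEpochs ε)).2 : ℝ) ≤
            C * ((m + (m : ℝ) ^ (5 / 7 : ℝ) * (L / μ) ^ (2 / 7 : ℝ)) * (1 + Real.log m) *
              Real.log (Real.log (1 / ε)))) := by
  refine ⟨40000, 208, by norm_num, by norm_num, fun CK CT => ⟨64 * (1 + |CK| * |CT|),
    by positivity, ?_⟩⟩
  intro E _ _ _ f μ L m z₀ zstar γ M K T hμ hL hm hsc hf hmin hγ hM hK hT hTD
  have hp : MSParams L γ M m K := ⟨hL, hm, hγ, hM, hK⟩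
  have hmin' : ∀ z, f zstar ≤ f z := fun z => hmin (Set.mem_univ z)
  have hnear : ‖z₀ - zstar‖ ≤ alenRadius μ γ T :=
    le_alenRadius hμ hp.γ_pos (norm_nonneg _) hTD
  refine ⟨fun s => norm_alenRestart_sub_sq_le hp hμ hsc hf hmin' hT hnear,
    fun ε => norm_alenRestart_numEpochs_sub_le_mul hp hμ hsc hf hmin' hT hnear,
    fun hTD3 ε => norm_alenRestart_numEpochs_sub_le hp hμ hsc hf hmin' hT hnear
      (le_alenRadius hμ hp.γ_pos (by positivity) hTD3),
    fun hKu hTu ε hε hε4 => total_work_le hm hp.m_le_K hT z₀ hε hε4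
      (hp.epoch_work_le hμ hKu hTu),
    fun hKu hTu ε hε hε4 => total_work_le hm hp.m_le_K hT z₀ hε hε4
      (hp.epoch_work_le_of_le_one_add hμ hKu hTu)⟩

theorem theorem6 :
    ∃ cK cT : ℝ, 0 < cK ∧ 0 < cT ∧ ∀ CK CT : ℝ, ∃ C : ℝ, 0 < C ∧
      ∀ (d : ℕ) (f : EuclideanSpace ℝ (Fin d) → ℝ) (μ L : ℝ) (m : ℕ)
        (z₀ zstar : EuclideanSpace ℝ (Fin d)) (γ M : ℝ) (K T : ℕ),
        0 < μ → 0 < L → 1 ≤ m →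
        StrongConvexOn Set.univ μ f →
        LazyNewton.HasLipschitzHessian L f →
        IsMinOn f Set.univ zstar →
        γ = L / m →
        M = 6 * m * (L + 2 * γ) →
        cK * (m * (1 + Real.log m)) ≤ K →
        1 ≤ T →
        cT * (γ * ‖z₀ - zstar‖ / μ) ^ (2 / 7 : ℝ) ≤ T →
        -- superlinear convergence
        (∀ s : ℕ, 1 ≤ s →
          ‖(LazyNewton.alenRestart f L z₀ T 2 K M m γ s).1 - zstar‖ ^ 2 ≤
            (1 / 2 : ℝ) ^ ((3 / 2 : ℝ) ^ s) * ‖z₀ - zstar‖ ^ 2) ∧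
        -- accuracy after `⌈log_{3/2} log_2 (1 / ε)⌉` epochs
        (∀ ε : ℝ, 0 < ε → ε < 1 / 2 →
          ‖(LazyNewton.alenRestart f L z₀ T 2 K M m γ (LazyNewton.numEpochs ε)).1 - zstar‖ ≤
            ε * ‖z₀ - zstar‖) ∧
        (cT * (γ * ‖z₀ - zstar‖ ^ 3 / μ) ^ (2 / 7 : ℝ) ≤ T →
          ∀ ε : ℝ, 0 < ε → ε < 1 / 2 →
          ‖(LazyNewton.alenRestart f L z₀ T 2 K M m γ (LazyNewton.numEpochs ε)).1 - zstar‖ ≤ ε) ∧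
        -- total number of steps
        ((K : ℝ) ≤ CK * (m * (1 + Real.log m)) →
          (T : ℝ) ≤ CT * (γ / μ) ^ (2 / 7 : ℝ) →
          ∀ ε : ℝ, 0 < ε → ε ≤ 1 / 4 →
          (LazyNewton.numEpochs ε : ℝ) * (m + T * K) ≤
            C * ((m + (m : ℝ) ^ (5 / 7 : ℝ) * (1 + Real.log m) * (L / μ) ^ (2 / 7 : ℝ)) *
              Real.log (Real.log (1 / ε))) ∧
          ((LazyNewton.alenRestart f L z₀ T 2 K M m γ (LazyNewton.numEpochs ε)).2 : ℝ) ≤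
            C * ((m + (m : ℝ) ^ (5 / 7 : ℝ) * (1 + Real.log m) * (L / μ) ^ (2 / 7 : ℝ)) *
              Real.log (Real.log (1 / ε)))) ∧
        -- the same when `γ / μ` may be so small that only the rounding makes `T` positive
        ((K : ℝ) ≤ CK * (m * (1 + Real.log m)) →
          (T : ℝ) ≤ CT * (1 + (γ / μ) ^ (2 / 7 : ℝ)) →
          ∀ ε : ℝ, 0 < ε → ε ≤ 1 / 4 →
          (LazyNewton.numEpochs ε : ℝ) * (m + T * K) ≤
            C * ((m + (m : ℝ) ^ (5 / 7 : ℝ) * (L / μ) ^ (2 / 7 : ℝ)) * (1 + Real.log m) *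
              Real.log (Real.log (1 / ε))) ∧
          ((LazyNewton.alenRestart f L z₀ T 2 K M m γ (LazyNewton.numEpochs ε)).2 : ℝ) ≤
            C * ((m + (m : ℝ) ^ (5 / 7 : ℝ) * (L / μ) ^ (2 / 7 : ℝ)) * (1 + Real.log m) *
              Real.log (Real.log (1 / ε)))) := by
  obtain ⟨cK, cT, hcK, hcT, h⟩ := theorem6_general
  exact ⟨cK, cT, hcK, hcT, fun CK CT => (h CK CT).imp fun _ hC => ⟨hC.1, fun d => hC.2 _⟩⟩
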